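/- **Setting.** For every sample size $n$ let $\beta\in\mathbb R^{d_n}$ ($d_n\ge 1$) be the parameter of a parametric measurement error model: $X$ is an unobserved covariate, $Z$ an error-free covariate, $W$ a surrogate of $X$, $Y$ the response; given $(X,Z)$, $W$ and $Y$ are independent with known densities $p_{W|X,Z}(w|x,z)$ and $p_{Y|X,Z}(y|x,z,\beta)$, and $(X,Z)$ has an arbitrary law. The model may change with $n$. Let $p^*_{X|Z}$ be a posited, possibly wrong, conditional density (with respect to a measure $\mu$), let $$S^*_\beta(W,Z,Y)=\frac{\partial}{\partial\beta}\log\int p_{W|X,Z}(W|x,Z)\,p_{Y|X,Z}(Y|x,Z,\beta)\,p^*_{X|Z}(x|Z)\,d\mu(x),$$ let $E^*\{\cdot|W,Z,Y\}$ be the conditional expectation computed with $p^*_{X|Z}$, let $a(X,Z)$ (which may depend on $\beta$) solve $E[E^*\{a(X,Z)|W,Z,Y\}|X,Z]=E\{S^*_\beta(W,Z,Y)|X,Z\}$, and put $S^*_{\rm eff}(W,Z,Y,\beta)=S^*_\beta(W,Z,Y)-E^*\{a(X,Z)|W,Z,Y\}$. The observations $(W_i,Z_i,Y_i)$, $i=1,\dots,n$,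 are i.i.d. from the model with true value $\beta_0=(\beta_{I0}^T,\beta_{II0}^T)^T$, where $\beta_{I0}\in\mathbb R^{d_1}$ has only non-zero components and $\beta_{II0}=0$ ($d_1\le d_n$ and $\beta_0$ may depend on $n$). A subscript $I$ on $S^*_{\rm eff}$ or $\partial/\partial\beta$ denotes the first $d_1$ components; expectations are under the true law. Let $p_\lambda(|\cdot|)$ be a penalty, differentiable off $0$, with $p'_\lambda(\gamma)=p'_\lambda(|\gamma|)\,{\rm sign}(\gamma)$ (so $p'_\lambda(0)=0$) and $p''_\lambda(\gamma)=p''_\lambda(|\gamma|)$ for $\gamma\ne0$, and let $\lambda_n>0$. The penalized estimating equation is $$\sum_{i=1}^nS^*_{\rm eff}(W_i,Z_i,Y_i,\beta)-n\{p'_{\lambda_n}(\beta_1),\dots,p'_{\lambda_n}(\beta_{d_n})\}^T=0 .\qquad(1)$$ Write $L_j(\beta)$ for the $j$th component of the sum. $\beta$ is a solution of (1) if each component either satisfies its equation, or has $\beta_j=0$ and $|L_j(\beta)|\le n\,p'_{\lambda_n}(0+)$, where $p'_{\lambda_n}(0+)=\liminf_{\gamma\to0+}p'_{\lambda_n}(\gamma)$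 (the left-hand side, which is discontinuous at $\beta_j=0$, crosses zero there). Let $b=\{p'_{\lambda_n}(\beta_{10}),\dots,p'_{\lambda_n}(\beta_{d_10})\}^T$, $\Sigma={\rm diag}\{p''_{\lambda_n}(\beta_{10}),\dots,p''_{\lambda_n}(\beta_{d_10})\}$, $V=E\{S^*_{{\rm eff},I}(\beta_0)S^{*T}_{{\rm eff},I}(\beta_0)\}$ and $G=E\{\partial S^*_{{\rm eff},I}(\beta_0)/\partial\beta_I^T\}-\Sigma$. **Assumptions.** (P1) $\lambda_n\to0$; $\max_{\beta_{j0}\ne0}|p'_{\lambda_n}(|\beta_{j0}|)|=O(n^{-1/2})$; $\max_{\beta_{j0}\ne0}|p''_{\lambda_n}(|\beta_{j0}|)|\to0$; and there are constants $C\ge0$ and $D$ such that for all $n$, $p''_{\lambda_n}$ exists on $(C\lambda_n,\infty)$ and $|p''_{\lambda_n}(\gamma_1)-p''_{\lambda_n}(\gamma_2)|\le D|\gamma_1-\gamma_2|$ for all $\gamma_1,\gamma_2>C\lambda_n$. Moreover the non-zero coefficients are large compared with $\lambda_n$: for every $K$, $\min_{\beta_{j0}\ne0}|\beta_{j0}|\ge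 K\lambda_n$ for all large $n$. (A1) $A=E\{\partial S^*_{\rm eff}(\beta_0)/\partial\beta^T\}$ exists and its singular values are bounded away from zero and infinity uniformly in $n$; the entries of $\partial S^*_{\rm eff}(\beta_0)/\partial\beta^T$ have second moments at most a constant $C_1$. (A2) The eigenvalues of $V$ lie in $[C_2,C_3]$ with constants $0<C_2\le C_3<\infty$, and $E(S_k^2S_j^2)\le C_4<\infty$ for all entries $S_k,S_j$ of $S^*_{\rm eff}(\beta_0)$, for all $n$. (A3) In a ball about $\beta_0$ whose radius does not depend on $n$, $S^*_{\rm eff}$ is twice differentiable in $\beta$, and the entries of its second derivatives are bounded by a function $B(W_i,Z_i,Y_i)$ with $E(B^2)\le C_5<\infty$ for all $n$. Finally, $d_n^5/n\to0$, and for every $K>0$ $$\inf_{0<\gamma\le K\sqrt{d_n/n}}\sqrt{n/d_n}\;p'_{\lambda_n}(\gamma)\longrightarrow\infty.\qquad(2)$$ **Theorem 2.** For every $K$, with probability tending to one every solution $\hat\beta=(\hat\beta_I^T,\hat\beta_{II}^T)^T$ of (1) with $\|\hat\beta-\beta_0\|\le K\sqrt{d_n/n}$ has $\hat\beta_{II}=0$.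 Consequently, if $\hat\beta_n$ are estimators which solve (1) with probability tending to one and satisfy $\|\hat\beta_n-\beta_0\|=O_p(\sqrt{d_n/n})$, then (i) $\hat\beta_{II}=0$ with probability tending to one, and (ii) if $G$ is invertible for all large $n$, then for all vectors $v=v_n\in\mathbb R^{d_1}$ with $v^Tv=1$, $$\sqrt n\,v^TV^{-1/2}G\left[\hat\beta_I-\beta_{I0}-G^{-1}b\right]\xrightarrow{D}N(0,1).$$ -/

import Mathlib

open MeasureTheory ProbabilityTheory Filter Topology
open scoped Matrix MatrixOrder

noncomputable section

/-- A parametric measurement error model with parameter `β ∈ ℝ^d`: `X` is the unobservable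
covariate, `Z` the error-free covariate, `W` the observed surrogate of `X`, and `Y` the response.
`pY`, `pW` are the conditional densities of `Y` and of `W` given `(X, Z)` with respect to `nuY` and
`nuW`; `pStar` is the posited (possibly wrong) conditional density of `X` given `Z` with respect to
`muX`; `lawXZ` is the true joint law of `(X, Z)`, which is arbitrary. -/
structure MEModel (𝒳 𝒵 𝒲 𝒴 : Type*) [MeasurableSpace 𝒳] [MeasurableSpace 𝒵]
    [MeasurableSpace 𝒲] [MeasurableSpace 𝒴] (d : ℕ) where
  muX : Measure 𝒳
  nuW : Measure 𝒲
  nuY : Measure 𝒴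
  sigmaFinite_muX : SigmaFinite muX
  sigmaFinite_nuW : SigmaFinite nuW
  sigmaFinite_nuY : SigmaFinite nuY
  pY : 𝒴 → 𝒳 → 𝒵 → EuclideanSpace ℝ (Fin d) → ℝ
  pW : 𝒲 → 𝒳 → 𝒵 → ℝ
  pStar : 𝒳 → 𝒵 → ℝ
  pY_nonneg : ∀ y x z β, 0 ≤ pY y x z β
  pW_nonneg : ∀ w x z, 0 ≤ pW w x z
  pStar_nonneg : ∀ x z, 0 ≤ pStar x z
  measurable_pY : ∀ β, Measurable fun t : 𝒴 × 𝒳 × 𝒵 => pY t.1 t.2.1 t.2.2 β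
  measurable_pW : Measurable fun t : 𝒲 × 𝒳 × 𝒵 => pW t.1 t.2.1 t.2.2
  measurable_pStar : Measurable fun t : 𝒳 × 𝒵 => pStar t.1 t.2
  lintegral_pY : ∀ x z β, ∫⁻ y, ENNReal.ofReal (pY y x z β) ∂nuY = 1
  lintegral_pW : ∀ x z, ∫⁻ w, ENNReal.ofReal (pW w x z) ∂nuW = 1
  lintegral_pStar : ∀ z, ∫⁻ x, ENNReal.ofReal (pStar x z) ∂muX = 1
  lawXZ : Measure (𝒳 × 𝒵)
  isProbabilityMeasure_lawXZ : IsProbabilityMeasure lawXZ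

namespace MEModel

variable {𝒳 𝒵 𝒲 𝒴 : Type*} [MeasurableSpace 𝒳] [MeasurableSpace 𝒵]
  [MeasurableSpace 𝒲] [MeasurableSpace 𝒴] {d : ℕ}

/-- The law of an observation `(W, Z, Y)` under the parameter `β`: `(X, Z)` has law `lawXZ`, and
given `(X, Z)` the pair `(W, Y)` has density `pW * pY`. -/
def obsLaw (M : MEModel 𝒳 𝒵 𝒲 𝒴 d) (β : EuclideanSpace ℝ (Fin d)) : Measure (𝒲 × 𝒵 × 𝒴) :=
  ((M.lawXZ.prod (M.nuW.prod M.nuY)).withDensity fun t =>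
      ENNReal.ofReal (M.pW t.2.1 t.1.1 t.1.2 * M.pY t.2.2 t.1.1 t.1.2 β)).map
    fun t => (t.2.1, t.1.2, t.2.2)

/-- The integrand `p(w | x, z) p(y | x, z, β) p*(x | z)` at the observation `o = (w, z, y)`. -/
def postKernel (M : MEModel 𝒳 𝒵 𝒲 𝒴 d) (β : EuclideanSpace ℝ (Fin d)) (o : 𝒲 × 𝒵 × 𝒴) (x : 𝒳) :
    ℝ :=
  M.pW o.1 x o.2.1 * M.pY o.2.2 x o.2.1 β * M.pStar x o.2.1

/-- The purported density `∫ p(w | x, z) p(y | x, z, β) p*(x | z) dμ(x)`. -/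
def mixDensity (M : MEModel 𝒳 𝒵 𝒲 𝒴 d) (o : 𝒲 × 𝒵 × 𝒴) (β : EuclideanSpace ℝ (Fin d)) : ℝ :=
  ∫ x, M.postKernel β o x ∂M.muX

/-- The purported score function `S*_β(W, Z, Y)`. -/
def score (M : MEModel 𝒳 𝒵 𝒲 𝒴 d) (β : EuclideanSpace ℝ (Fin d)) (o : 𝒲 × 𝒵 × 𝒴) :
    EuclideanSpace ℝ (Fin d) :=
  gradient (fun β' => Real.log (M.mixDensity o β')) β

/-- `E*{f(X, Z) | W, Z, Y}`, the conditional expectation under the posited density `p*`. -/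
def postMean (M : MEModel 𝒳 𝒵 𝒲 𝒴 d) (β : EuclideanSpace ℝ (Fin d))
    (f : 𝒳 → 𝒵 → EuclideanSpace ℝ (Fin d)) (o : 𝒲 × 𝒵 × 𝒴) : EuclideanSpace ℝ (Fin d) :=
  (M.mixDensity o β)⁻¹ • ∫ x, M.postKernel β o x • f x o.2.1 ∂M.muX

/-- The integrand of `E{g(W, Z, Y) | X = x, Z = z}`. -/
def condIntegrand (M : MEModel 𝒳 𝒵 𝒲 𝒴 d) (β : EuclideanSpace ℝ (Fin d))
    (g : 𝒲 × 𝒵 × 𝒴 → EuclideanSpace ℝ (Fin d)) (x : 𝒳) (z : 𝒵) (t : 𝒲 × 𝒴) :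
    EuclideanSpace ℝ (Fin d) :=
  (M.pW t.1 x z * M.pY t.2 x z β) • g (t.1, z, t.2)

/-- `E{g(W, Z, Y) | X = x, Z = z}` under the parameter `β`. -/
def condMean (M : MEModel 𝒳 𝒵 𝒲 𝒴 d) (β : EuclideanSpace ℝ (Fin d))
    (g : 𝒲 × 𝒵 × 𝒴 → EuclideanSpace ℝ (Fin d)) (x : 𝒳) (z : 𝒵) : EuclideanSpace ℝ (Fin d) :=
  ∫ t, M.condIntegrand β g x z t ∂(M.nuW.prod M.nuY)

/-- The function `a(X, Z)` (which may depend on `β`) solves the integral equation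
`E[E*{a(X, Z) | W, Z, Y} | X, Z] = E{S*_β(W, Z, Y) | X, Z}`, all the objects in it being well
defined: the purported score exists and the (conditional) expectations are those of integrable
functions. -/
structure SolvesIntegralEq (M : MEModel 𝒳 𝒵 𝒲 𝒴 d)
    (a : EuclideanSpace ℝ (Fin d) → 𝒳 → 𝒵 → EuclideanSpace ℝ (Fin d)) : Prop where
  measurable : ∀ β, Measurable fun t : 𝒳 × 𝒵 => a β t.1 t.2
  score_exists : ∀ β, ∀ᵐ o ∂(M.obsLaw β),
    0 < M.mixDensity o β ∧ DifferentiableAt ℝ (M.mixDensity o) β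
  postMean_exists : ∀ β, ∀ᵐ o ∂(M.obsLaw β),
    Integrable (fun x => M.postKernel β o x • a β x o.2.1) M.muX
  condMean_exists : ∀ β, ∀ᵐ t ∂M.lawXZ,
    Integrable (M.condIntegrand β (M.postMean β (a β)) t.1 t.2) (M.nuW.prod M.nuY) ∧
    Integrable (M.condIntegrand β (M.score β) t.1 t.2) (M.nuW.prod M.nuY)
  equation : ∀ β, ∀ᵐ t ∂M.lawXZ,
    M.condMean β (M.postMean β (a β)) t.1 t.2 = M.condMean β (M.score β) t.1 t.2

/-- `S*_eff(W, Z, Y, β) = S*_β(W, Z, Y) - E*{a(X, Z) | W, Z, Y}`. -/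
def effScore (M : MEModel 𝒳 𝒵 𝒲 𝒴 d)
    (a : EuclideanSpace ℝ (Fin d) → 𝒳 → 𝒵 → EuclideanSpace ℝ (Fin d))
    (o : 𝒲 × 𝒵 × 𝒴) (β : EuclideanSpace ℝ (Fin d)) : EuclideanSpace ℝ (Fin d) :=
  M.score β o - M.postMean β (a β) o

/-- The `(j, k)` entry of `∂S*_eff(β) / ∂βᵀ`. -/
def effScoreDeriv (M : MEModel 𝒳 𝒵 𝒲 𝒴 d)
    (a : EuclideanSpace ℝ (Fin d) → 𝒳 → 𝒵 → EuclideanSpace ℝ (Fin d))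
    (β : EuclideanSpace ℝ (Fin d)) (j k : Fin d) (o : 𝒲 × 𝒵 × 𝒴) : ℝ :=
  (fderiv ℝ (M.effScore a o) β (EuclideanSpace.single k 1)) j

/-- The matrix `E{∂S*_eff(β₀) / ∂βᵀ}`, the expectation being taken under the true value `β₀`. -/
def meanDeriv (M : MEModel 𝒳 𝒵 𝒲 𝒴 d)
    (a : EuclideanSpace ℝ (Fin d) → 𝒳 → 𝒵 → EuclideanSpace ℝ (Fin d))
    (β₀ : EuclideanSpace ℝ (Fin d)) : Matrix (Fin d) (Fin d) ℝ :=
  Matrix.of fun j k => ∫ o, M.effScoreDeriv a β₀ j k o ∂(M.obsLaw β₀)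

/-- The matrix `E{∂S*_eff,I(β_I0) / ∂β_Iᵀ}`, where `I` stands for the first `d₁` components. -/
def meanDerivI (M : MEModel 𝒳 𝒵 𝒲 𝒴 d)
    (a : EuclideanSpace ℝ (Fin d) → 𝒳 → 𝒵 → EuclideanSpace ℝ (Fin d))
    (β₀ : EuclideanSpace ℝ (Fin d)) {d₁ : ℕ} (h : d₁ ≤ d) : Matrix (Fin d₁) (Fin d₁) ℝ :=
  (M.meanDeriv a β₀).submatrix (Fin.castLE h) (Fin.castLE h)

/-- The matrix `E{S*_eff,I(β_I0) S*_eff,I(β_I0)ᵀ}`. -/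
def covI (M : MEModel 𝒳 𝒵 𝒲 𝒴 d)
    (a : EuclideanSpace ℝ (Fin d) → 𝒳 → 𝒵 → EuclideanSpace ℝ (Fin d))
    (β₀ : EuclideanSpace ℝ (Fin d)) {d₁ : ℕ} (h : d₁ ≤ d) : Matrix (Fin d₁) (Fin d₁) ℝ :=
  Matrix.of fun j k =>
    ∫ o, M.effScore a o β₀ (Fin.castLE h j) * M.effScore a o β₀ (Fin.castLE h k) ∂(M.obsLaw β₀)

end MEModel

/-- All real eigenvalues of the square matrix `A` lie in `[lo, hi]`. -/
def EigenvaluesIn {m : ℕ} (A : Matrix (Fin m) (Fin m) ℝ) (lo hi : ℝ) : Prop :=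
  ∀ t : ℝ, Module.End.HasEigenvalue (Matrix.toLin' A) t → lo ≤ t ∧ t ≤ hi

namespace MEModel

variable {𝒳 𝒵 𝒲 𝒴 : Type*} [MeasurableSpace 𝒳] [MeasurableSpace 𝒵]
  [MeasurableSpace 𝒲] [MeasurableSpace 𝒴] {d : ℕ}

/-- First derivative of `S*_eff` at `β₀`: its expectation `A` exists, the squared singular values of
`A` (the eigenvalues of `A Aᵀ`, whose eigenvectors are the left singular vectors) lie in
`[lo, hi]`, and the entries have second moments at most `C₁`. -/
structure CondA1 (M : MEModel 𝒳 𝒵 𝒲 𝒴 d)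
    (a : EuclideanSpace ℝ (Fin d) → 𝒳 → 𝒵 → EuclideanSpace ℝ (Fin d))
    (β₀ : EuclideanSpace ℝ (Fin d)) (lo hi C₁ : ℝ) : Prop where
  differentiable : ∀ᵐ o ∂(M.obsLaw β₀), DifferentiableAt ℝ (M.effScore a o) β₀
  integrable : ∀ j k, Integrable (M.effScoreDeriv a β₀ j k) (M.obsLaw β₀)
  eigenvalues : EigenvaluesIn (M.meanDeriv a β₀ * (M.meanDeriv a β₀)ᵀ) lo hi
  integrable_sq : ∀ j k, Integrable (fun o => M.effScoreDeriv a β₀ j k o ^ 2) (M.obsLaw β₀)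
  moment : ∀ j k, ∫ o, M.effScoreDeriv a β₀ j k o ^ 2 ∂(M.obsLaw β₀) ≤ C₁

/-- Moments of `S*_eff(β₀)`: the eigenvalues of `E(S*_eff,I S*_eff,Iᵀ)` lie in `[C₂, C₃]` and
`E(S_k² S_j²) ≤ C₄` for all entries. -/
structure CondA2 (M : MEModel 𝒳 𝒵 𝒲 𝒴 d)
    (a : EuclideanSpace ℝ (Fin d) → 𝒳 → 𝒵 → EuclideanSpace ℝ (Fin d))
    (β₀ : EuclideanSpace ℝ (Fin d)) {d₁ : ℕ} (h : d₁ ≤ d) (C₂ C₃ C₄ : ℝ) : Prop where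
  eigenvalues : EigenvaluesIn (M.covI a β₀ h) C₂ C₃
  integrable : ∀ j k,
    Integrable (fun o => M.effScore a o β₀ k ^ 2 * M.effScore a o β₀ j ^ 2) (M.obsLaw β₀)
  moment : ∀ j k,
    ∫ o, M.effScore a o β₀ k ^ 2 * M.effScore a o β₀ j ^ 2 ∂(M.obsLaw β₀) ≤ C₄

/-- Second derivatives of `S*_eff`: they exist in the ball of radius `r` about `β₀`, and their
entries are bounded there by a function `B(W, Z, Y)` with `E(B²) ≤ C₅`. -/
structure CondA3 (M : MEModel 𝒳 𝒵 𝒲 𝒴 d)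
    (a : EuclideanSpace ℝ (Fin d) → 𝒳 → 𝒵 → EuclideanSpace ℝ (Fin d))
    (β₀ : EuclideanSpace ℝ (Fin d)) (r C₅ : ℝ) : Prop where
  aemeasurable : ∀ β ∈ Metric.ball β₀ r,
    AEMeasurable (fun o => M.effScore a o β) (M.obsLaw β₀)
  bound : ∃ B : 𝒲 × 𝒵 × 𝒴 → ℝ, AEMeasurable B (M.obsLaw β₀) ∧
    Integrable (fun o => B o ^ 2) (M.obsLaw β₀) ∧ ∫ o, B o ^ 2 ∂(M.obsLaw β₀) ≤ C₅ ∧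
    ∀ᵐ o ∂(M.obsLaw β₀), ∀ β ∈ Metric.ball β₀ r,
      DifferentiableAt ℝ (M.effScore a o) β ∧
      DifferentiableAt ℝ (fderiv ℝ (M.effScore a o)) β ∧
      ∀ j k l, |(fderiv ℝ (fderiv ℝ (M.effScore a o)) β
        (EuclideanSpace.single k 1) (EuclideanSpace.single l 1)) j| ≤ B o

end MEModel

/-- The derivative `p'(γ)` of the penalty `γ ↦ p(|γ|)`, with `p'(γ) = p'(|γ|) sign(γ)`, so that
`p'(0) = 0`. -/
def penDeriv (p : ℝ → ℝ) (γ : ℝ) : ℝ := deriv p |γ| * Real.sign γ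

/-- The second derivative `p''(γ)` at `γ ≠ 0` of the penalty `γ ↦ p(|γ|)`. -/
def penDeriv2 (p : ℝ → ℝ) (γ : ℝ) : ℝ := deriv (deriv p) |γ|

/-- `max {|p'(|β_j|)| : β_j ≠ 0}` (zero if there is no such `j`). -/
def maxPenDeriv (p : ℝ → ℝ) {d : ℕ} (β : EuclideanSpace ℝ (Fin d)) : ℝ :=
  ⨆ j : {j : Fin d // β j ≠ 0}, abs (penDeriv p (abs (β j)))

/-- `max {|p''(|β_j|)| : β_j ≠ 0}` (zero if there is no such `j`). -/
def maxPenDeriv2 (p : ℝ → ℝ) {d : ℕ} (β : EuclideanSpace ℝ (Fin d)) : ℝ :=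
  ⨆ j : {j : Fin d // β j ≠ 0}, abs (penDeriv2 p (abs (β j)))

/-- The condition on the penalty `p_λ(|·|)`, the tuning parameters `λ_n` and the true values. -/
structure CondP1 (p : ℝ → ℝ → ℝ) (lam : ℕ → ℝ) {d : ℕ → ℕ}
    (β₀ : ∀ n, EuclideanSpace ℝ (Fin (d n))) : Prop where
  lam_tendsto : Tendsto lam atTop (𝓝 0)
  first : (fun n => maxPenDeriv (p (lam n)) (β₀ n)) =O[atTop] fun n : ℕ => 1 / √(n : ℝ)
  second : Tendsto (fun n => maxPenDeriv2 (p (lam n)) (β₀ n)) atTop (𝓝 0)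
  smooth : ∃ C D : ℝ, 0 ≤ C ∧ ∀ n,
    (∀ γ, C * lam n < γ → DifferentiableAt ℝ (deriv (p (lam n))) γ) ∧
    ∀ γ₁ γ₂, C * lam n < γ₁ → C * lam n < γ₂ →
      |penDeriv2 (p (lam n)) γ₁ - penDeriv2 (p (lam n)) γ₂| ≤ D * |γ₁ - γ₂|

/-- The penalty derivative condition, uniformly at the scale of the estimation error: for every
`K > 0`, `inf {√(n / d_n) p'_{λ_n}(γ) : 0 < γ ≤ K √(d_n / n)} → ∞`. -/
def PenaltyDominates (p : ℝ → ℝ → ℝ) (lam : ℕ → ℝ) (d : ℕ → ℕ) : Prop :=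
  ∀ K > 0, ∀ B : ℝ, ∀ᶠ n : ℕ in atTop, ∀ γ : ℝ, 0 < γ → γ ≤ K * √((d n : ℝ) / n) →
    B ≤ √((n : ℝ) / d n) * penDeriv (p (lam n)) γ

/-- `β` solves the penalized estimating equation `L(β) - n p'(β) = 0`, where `L` is the sum of the
`n` estimating functions. Since `p'` may jump at `0` from `-p'(0+)` to `p'(0+)`, a component
`β_j = 0` also solves its equation if the left-hand side crosses zero there, that is, if
`|L_j(β)| ≤ n p'(0+)`; here `p'(0+)` is the lower right limit. -/
def IsPenalizedRoot (p : ℝ → ℝ) (n : ℕ) {d : ℕ}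
    (L : EuclideanSpace ℝ (Fin d) → EuclideanSpace ℝ (Fin d)) (β : EuclideanSpace ℝ (Fin d)) :
    Prop :=
  ∀ j, L β j - n * penDeriv p (β j) = 0 ∨
    (β j = 0 ∧ ((|L β j| / n : ℝ) : EReal) ≤
      liminf (fun γ : ℝ => ((penDeriv p γ : ℝ) : EReal)) (𝓝[>] 0))

/-- The vector `b` of the first derivatives of the penalty at the first `d₁` components. -/
def biasVec (p : ℝ → ℝ) {d d₁ : ℕ} (h : d₁ ≤ d) (β₀ : EuclideanSpace ℝ (Fin d)) : Fin d₁ → ℝ :=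
  fun j => penDeriv p (β₀ (Fin.castLE h j))

/-- The diagonal matrix `Σ` of the second derivatives of the penalty at the first `d₁`
components. -/
def penHess (p : ℝ → ℝ) {d d₁ : ℕ} (h : d₁ ≤ d) (β₀ : EuclideanSpace ℝ (Fin d)) :
    Matrix (Fin d₁) (Fin d₁) ℝ :=
  Matrix.diagonal fun j => penDeriv2 p (β₀ (Fin.castLE h j))

/-- The inverse square root `V^{-1/2}` of a positive definite matrix. -/
def invSqrt {m : ℕ} (V : Matrix (Fin m) (Fin m) ℝ) : Matrix (Fin m) (Fin m) ℝ :=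
  (CFC.sqrt V)⁻¹

/-- The statistic `√n vᵀ V^{-1/2} G [β_I - β_I0 - G⁻¹ b]`. -/
def standardized (n : ℕ) {d d₁ : ℕ} (h : d₁ ≤ d) (v : Fin d₁ → ℝ)
    (V G : Matrix (Fin d₁) (Fin d₁) ℝ) (b : Fin d₁ → ℝ) (β₀ β : EuclideanSpace ℝ (Fin d)) : ℝ :=
  √(n : ℝ) * (v ⬝ᵥ ((invSqrt V * G) *ᵥ
    ((fun j => β (Fin.castLE h j) - β₀ (Fin.castLE h j)) - G⁻¹ *ᵥ b)))

end

/-! Both conclusions follow from one event of probability close to one, on which the rest of the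
argument is deterministic (`LinearizesAt`). Write `δ = β - β₀`. On this event, throughout a ball of
fixed radius, `L(β) = L(β₀) + n A δ + T δ + R` with `|L(β₀)|² = O(n d)`, Frobenius norm of `T` of
order `√n d`, and entries of `R` of order `n d |δ|²`. The score has mean zero at `β₀`, because its
conditional mean given `(X, Z)` vanishes by the integral equation. The first two bounds are
therefore second moment bounds for centred i.i.d. sums; the third is Taylor's formula with the
dominating function `B`. Since all `β` in the ball are controlled at once, every root is covered.

Sparsity: if `|δ| ≤ K √(d/n)`, each component of `L(β)` is `O(√(n d))`, as the rows of `A` are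
bounded and `d³ ≤ n`. A root with `β_j ≠ 0` has `|L_j(β)| = n |p'(β_j)|`, and when `β_{j0} = 0` the
domination condition makes this larger than any fixed multiple of `√(n d)`, a contradiction.

Normality: domination together with `p'(|β_{j0}|) = O(n^{-1/2})` forces the non-zero `β_{j0}` to be
large compared with `√(d/n)`, so `β_j` keeps the sign of `β_{j0}` and `p'` can be expanded there
(`CondP1.eventually_taylor`). With the other components equal to zero, the equations become `G δ_I -
b + L_I(β₀)/n = ρ`, where the entries of `ρ` are `O(d²/n)`. Pairing with `√n u`, `u = V^{-1/2} v`,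
leaves an error `O(√(d⁵/n))`, which vanishes. The main term `-n^{-1/2} uᵀ L_I(β₀)` is a normalized
i.i.d. sum of variance one whose summands have fourth moment `O(d²) = o(n)`, and a characteristic
function argument gives the limit (`tendstoInDistribution_of_sub_iid_sum`). -/

/-! ### Taylor bounds -/

/-- Second order remainder of a real function with a derivative that is Lipschitz at `0`. -/
lemma abs_sub_sub_deriv_le {g g' : ℝ → ℝ} {C : ℝ}
    (hg : ∀ t ∈ Set.Icc (0 : ℝ) 1, HasDerivAt g (g' t) t)
    (hC : ∀ t ∈ Set.Icc (0 : ℝ) 1, |g' t - g' 0| ≤ C) :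
    |g 1 - g 0 - g' 0| ≤ C := by
  -- The mean value inequality is applied to `g` minus its linear part at `0`.
  have h := norm_image_sub_le_of_norm_deriv_le_segment_01' (f := fun t => g t - t * g' 0)
    (f' := fun t => g' t - g' 0) (C := C)
    (fun t ht => by
      simpa using ((hg t ht).fun_sub ((hasDerivAt_id t).mul_const (g' 0))).hasDerivWithinAt)
    (fun t ht => hC t ⟨ht.1, ht.2.le⟩)
  have h2 : g 1 - 1 * g' 0 - (g 0 - 0 * g' 0) = g 1 - g 0 - g' 0 := by ring
  rw [Real.norm_eq_abs, h2] at h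
  exact h

lemma sum_abs_sq_le {d : ℕ} (x : EuclideanSpace ℝ (Fin d)) :
    (∑ k, |x k|) ^ 2 ≤ d * ‖x‖ ^ 2 := by
  have := sq_sum_le_card_mul_sum_sq (s := (Finset.univ : Finset (Fin d))) (f := fun k => |x k|)
  simpa [EuclideanSpace.real_norm_sq_eq] using this

lemma abs_apply_le_norm {d : ℕ} (x : EuclideanSpace ℝ (Fin d)) (j : Fin d) : |x j| ≤ ‖x‖ := by
  simpa using PiLp.norm_apply_le x j

lemma sum_smul_single {d : ℕ} (x : EuclideanSpace ℝ (Fin d)) :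
    ∑ k, x k • EuclideanSpace.single k (1 : ℝ) = x := by
  ext i
  simp [Pi.single_apply]

lemma clm_apply_eq_sum {d : ℕ} {F : Type*} [AddCommGroup F] [Module ℝ F] [TopologicalSpace F]
    (T : EuclideanSpace ℝ (Fin d) →L[ℝ] F) (x : EuclideanSpace ℝ (Fin d)) :
    T x = ∑ k, x k • T (EuclideanSpace.single k 1) := by
  conv_lhs => rw [← sum_smul_single x]
  simp

/-- Second order Taylor bound in a ball for a vector field whose second partial derivatives are
bounded there. -/
lemma abs_taylor_two_le {d : ℕ} {f : EuclideanSpace ℝ (Fin d) → EuclideanSpace ℝ (Fin d)}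
    {β₀ β : EuclideanSpace ℝ (Fin d)} {r B : ℝ} (hβ : β ∈ Metric.ball β₀ r)
    (hf : ∀ β' ∈ Metric.ball β₀ r, DifferentiableAt ℝ f β' ∧
      DifferentiableAt ℝ (fderiv ℝ f) β' ∧
      ∀ j k l, |(fderiv ℝ (fderiv ℝ f) β'
        (EuclideanSpace.single k 1) (EuclideanSpace.single l 1)) j| ≤ B) (j : Fin d) :
    |f β j - f β₀ j - ∑ k, (fderiv ℝ f β₀ (EuclideanSpace.single k 1)) j * (β - β₀) k| ≤
      B * (d * ‖β - β₀‖ ^ 2) := by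
  set δ := β - β₀ with hδ
  have hr : 0 < r := dist_nonneg.trans_lt (Metric.mem_ball.1 hβ)
  have hmem : ∀ t ∈ Set.Icc (0 : ℝ) 1, β₀ + t • δ ∈ Metric.ball β₀ r := by
    intro t ht
    rw [mem_ball_iff_norm] at hβ ⊢
    rw [add_sub_cancel_left, norm_smul, Real.norm_of_nonneg ht.1]
    exact (mul_le_of_le_one_left (norm_nonneg _) ht.2).trans_lt hβ
  have hline : ∀ t : ℝ, HasDerivAt (fun t : ℝ => β₀ + t • δ) δ t := fun t => by
    simpa using ((hasDerivAt_id t).smul_const δ).const_add β₀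
  have hB : 0 ≤ B := (abs_nonneg _).trans ((hf β hβ).2.2 j j j)
  have hg : ∀ t ∈ Set.Icc (0 : ℝ) 1, HasDerivAt (fun t : ℝ => f (β₀ + t • δ) j)
      ((fderiv ℝ f (β₀ + t • δ) δ) j) t := by
    intro t ht
    have h := (hf _ (hmem t ht)).1.hasFDerivAt.comp_hasDerivAt t (hline t)
    exact ((EuclideanSpace.proj j : EuclideanSpace ℝ (Fin d) →L[ℝ] ℝ).hasFDerivAt.comp_hasDerivAt t
      h)
  have hg' : ∀ t ∈ Set.Icc (0 : ℝ) 1, HasDerivAt (fun t : ℝ => (fderiv ℝ f (β₀ + t • δ) δ) j)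
      ((fderiv ℝ (fderiv ℝ f) (β₀ + t • δ) δ δ) j) t := by
    intro t ht
    have h := (hf _ (hmem t ht)).2.1.hasFDerivAt.comp_hasDerivAt t (hline t)
    have h2 := h.clm_apply (hasDerivAt_const t δ)
    simp only [map_zero, add_zero] at h2
    exact ((EuclideanSpace.proj j : EuclideanSpace ℝ (Fin d) →L[ℝ] ℝ).hasFDerivAt.comp_hasDerivAt t
      h2)
  -- Expanding the bilinear form in the standard basis gives `B (∑ |δ_k|)²`; the factor `d` is the
  -- cost of passing from the `ℓ¹` to the Euclidean norm.
  have hbound : ∀ t ∈ Set.Icc (0 : ℝ) 1,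
      |(fderiv ℝ (fderiv ℝ f) (β₀ + t • δ) δ δ) j| ≤ B * (d * ‖δ‖ ^ 2) := by
    intro t ht
    have hexp : (fderiv ℝ (fderiv ℝ f) (β₀ + t • δ) δ δ) j = ∑ k, ∑ l, δ k * (δ l *
        (fderiv ℝ (fderiv ℝ f) (β₀ + t • δ) (EuclideanSpace.single k 1)
          (EuclideanSpace.single l 1)) j) := by
      rw [clm_apply_eq_sum (fderiv ℝ (fderiv ℝ f) (β₀ + t • δ)) δ]
      simp only [_root_.sum_apply, _root_.smul_apply, WithLp.ofLp_sum,
        WithLp.ofLp_smul, Finset.sum_apply, Pi.smul_apply, smul_eq_mul]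
      refine Finset.sum_congr rfl fun k _ => ?_
      rw [clm_apply_eq_sum (fderiv ℝ (fderiv ℝ f) (β₀ + t • δ) (EuclideanSpace.single k 1)) δ]
      simp [Finset.mul_sum]
    rw [hexp]
    calc _ ≤ ∑ k, ∑ l, |δ k| * (|δ l| * B) := by
          refine (Finset.abs_sum_le_sum_abs _ _).trans (Finset.sum_le_sum fun k _ => ?_)
          refine (Finset.abs_sum_le_sum_abs _ _).trans (Finset.sum_le_sum fun l _ => ?_)
          rw [abs_mul, abs_mul]
          gcongr
          exact (hf _ (hmem t ht)).2.2 j k l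
      _ = B * (∑ k, |δ k|) ^ 2 := by
          rw [sq, Finset.sum_mul_sum, Finset.mul_sum]
          refine Finset.sum_congr rfl fun k _ => ?_
          rw [Finset.mul_sum]
          exact Finset.sum_congr rfl fun l _ => by ring
      _ ≤ _ := mul_le_mul_of_nonneg_left (sum_abs_sq_le δ) hB
  have hlip : ∀ t ∈ Set.Icc (0 : ℝ) 1,
      |(fderiv ℝ f (β₀ + t • δ) δ) j - (fderiv ℝ f (β₀ + (0 : ℝ) • δ) δ) j| ≤
        B * (d * ‖δ‖ ^ 2) := by
    intro t ht
    have h := norm_image_sub_le_of_norm_deriv_le_segment'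
      (f := fun t : ℝ => (fderiv ℝ f (β₀ + t • δ) δ) j) (a := 0) (b := 1)
      (fun s hs => (hg' s hs).hasDerivWithinAt)
      (fun s hs => (hbound s ⟨hs.1, hs.2.le⟩)) t ht
    refine h.trans ?_
    rw [sub_zero]
    exact mul_le_of_le_one_right (by positivity) ht.2
  have hmain := abs_sub_sub_deriv_le hg hlip
  have h1 : β₀ + (1 : ℝ) • δ = β := by simp [hδ]
  have h0 : β₀ + (0 : ℝ) • δ = β₀ := by simp
  rw [h1, h0] at hmain
  convert hmain using 3
  rw [clm_apply_eq_sum (fderiv ℝ f β₀) δ]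
  simp [mul_comm]

/-- Second order Taylor bound on a half line for a function with Lipschitz derivative. -/
lemma abs_taylor_one_le_of_lipschitz {q : ℝ → ℝ} {c D x y : ℝ}
    (hq : ∀ γ, c < γ → DifferentiableAt ℝ q γ)
    (hL : ∀ γ₁ γ₂, c < γ₁ → c < γ₂ → |deriv q γ₁ - deriv q γ₂| ≤ D * |γ₁ - γ₂|)
    (hx : c < x) (hy : c < y) :
    |q y - q x - deriv q x * (y - x)| ≤ D * (y - x) ^ 2 := by
  have hmem : ∀ t ∈ Set.Icc (0 : ℝ) 1, c < x + t * (y - x) := by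
    intro t ht
    rcases le_total x y with h | h
    · nlinarith [mul_nonneg ht.1 (sub_nonneg.2 h)]
    · nlinarith [mul_nonneg (sub_nonneg.2 ht.2) (sub_nonneg.2 h)]
  have hD : 0 ≤ D := by
    have := (abs_nonneg _).trans (hL (c + 1) (c + 2) (by linarith) (by linarith))
    norm_num at this
    exact this
  have h := abs_sub_sub_deriv_le (g := fun t => q (x + t * (y - x)))
    (g' := fun t => deriv q (x + t * (y - x)) * (y - x)) (C := D * (y - x) ^ 2)
    (fun t ht => by
      have hl : HasDerivAt (fun t : ℝ => x + t * (y - x)) (y - x) t := by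
        simpa using ((hasDerivAt_id t).mul_const (y - x)).const_add x
      exact (hq _ (hmem t ht)).hasDerivAt.comp t hl)
    (fun t ht => by
      rw [← sub_mul, abs_mul]
      refine (mul_le_mul_of_nonneg_right (hL _ _ (hmem t ht) (hmem 0 (by simp)))
        (abs_nonneg _)).trans ?_
      have : x + t * (y - x) - (x + 0 * (y - x)) = t * (y - x) := by ring
      rw [this, abs_mul, abs_of_nonneg ht.1, ← sq_abs (y - x)]
      have := mul_le_of_le_one_left (mul_nonneg hD (sq_nonneg |y - x|)) ht.2
      linarith)
  simpa using h

/-- Second order Taylor bound for the derivative of a penalty at a point `x` that is far from `0`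
compared with the increment. -/
lemma abs_penDeriv_taylor_le {p : ℝ → ℝ} {c D x y : ℝ} (hc : 0 ≤ c)
    (hq : ∀ γ, c < γ → DifferentiableAt ℝ (deriv p) γ)
    (hL : ∀ γ₁ γ₂, c < γ₁ → c < γ₂ → |penDeriv2 p γ₁ - penDeriv2 p γ₂| ≤ D * |γ₁ - γ₂|)
    (hx : c < |x| / 2) (hxy : |y - x| ≤ |x| / 2) :
    y ≠ 0 ∧ |penDeriv p y - penDeriv p x - penDeriv2 p x * (y - x)| ≤ D * (y - x) ^ 2 := by
  have hL' : ∀ γ₁ γ₂, c < γ₁ → c < γ₂ →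
      |deriv (deriv p) γ₁ - deriv (deriv p) γ₂| ≤ D * |γ₁ - γ₂| := by
    intro γ₁ γ₂ h1 h2
    simpa [penDeriv2, abs_of_pos (hc.trans_lt h1), abs_of_pos (hc.trans_lt h2)] using
      hL γ₁ γ₂ h1 h2
  obtain ⟨h1, h2⟩ := abs_le.1 hxy
  -- An increment of at most `|x| / 2` keeps `y` on the same side of `0` as `x` and leaves `|y| ≥
  -- |x| / 2 > c`. The negative case reduces to the positive one because `penDeriv p` is odd.
  rcases lt_trichotomy x 0 with h | h | h
  · rw [abs_of_neg h] at *
    have hy : y < 0 := by linarith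
    refine ⟨hy.ne, ?_⟩
    have := abs_taylor_one_le_of_lipschitz hq hL' (x := -x) (y := -y) (by linarith) (by linarith)
    simp only [penDeriv, penDeriv2, abs_of_neg h, abs_of_neg hy, Real.sign_of_neg h,
      Real.sign_of_neg hy]
    rw [← abs_neg]
    convert this using 2 <;> ring
  · subst h; simp at hx; linarith
  · rw [abs_of_pos h] at *
    have hy : 0 < y := by linarith
    refine ⟨hy.ne', ?_⟩
    have := abs_taylor_one_le_of_lipschitz hq hL' (x := x) (y := y) (by linarith) (by linarith)
    simp only [penDeriv, penDeriv2, abs_of_pos h, abs_of_pos hy, Real.sign_of_pos h,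
      Real.sign_of_pos hy]
    convert this using 2; ring

/-- Since `penDeriv p` is odd, a lower bound on it at positive arguments controls its modulus at
arguments of either sign. -/
lemma penDeriv_abs_le_abs (p : ℝ → ℝ) (γ : ℝ) : penDeriv p |γ| ≤ |penDeriv p γ| := by
  rcases lt_trichotomy γ 0 with h | h | h
  · simp [penDeriv, Real.sign_of_neg h, Real.sign_of_pos (abs_pos.2 h.ne), le_abs_self]
  · simp [penDeriv, h]
  · rw [abs_of_pos h]; exact le_abs_self _

/-! ### Matrices -/

namespace EigenvaluesIn

variable {m : ℕ} {V : Matrix (Fin m) (Fin m) ℝ} {lo hi : ℝ}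

lemma hasEigenvalue_of_mulVec {V : Matrix (Fin m) (Fin m) ℝ} {x : Fin m → ℝ} {t : ℝ}
    (hx : x ≠ 0) (h : V *ᵥ x = t • x) : Module.End.HasEigenvalue (Matrix.toLin' V) t :=
  Module.End.hasEigenvalue_of_hasEigenvector
    (x := x) ⟨Module.End.mem_eigenspace_iff.2 (by simpa using h), hx⟩

lemma eigenvectorBasis_ne_zero (hV : V.IsHermitian) (i : Fin m) :
    (hV.eigenvectorBasis i : Fin m → ℝ) ≠ 0 := by
  intro h
  have := hV.eigenvectorBasis.orthonormal.ne_zero i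
  exact this (by ext j; exact congrFun h j)

/-- Shifting by `lo` moves the eigenvalues of `V - lo • 1` to those of `V`, so this symmetric matrix
is positive semidefinite. -/
lemma le_dotProduct (h : EigenvaluesIn V lo hi) (hV : V.IsHermitian) (x : Fin m → ℝ) :
    lo * (x ⬝ᵥ x) ≤ x ⬝ᵥ (V *ᵥ x) := by
  have hH : (V - lo • (1 : Matrix (Fin m) (Fin m) ℝ)).IsHermitian :=
    hV.sub (by simp [Matrix.IsHermitian])
  have hps : (V - lo • (1 : Matrix (Fin m) (Fin m) ℝ)).PosSemidef := by
    rw [hH.posSemidef_iff_eigenvalues_nonneg]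
    intro i
    have hm := hH.mulVec_eigenvectorBasis i
    have := (h _ (hasEigenvalue_of_mulVec (eigenvectorBasis_ne_zero hH i)
      (t := hH.eigenvalues i + lo) (by
        rw [add_smul, ← hm, Matrix.sub_mulVec, Matrix.smul_mulVec, Matrix.one_mulVec]
        simp))).1
    simpa using this
  have := hps.dotProduct_mulVec_nonneg x
  rw [Matrix.sub_mulVec, Matrix.smul_mulVec, Matrix.one_mulVec] at this
  simp at this
  linarith

lemma dotProduct_le (h : EigenvaluesIn V lo hi) (hV : V.IsHermitian) (x : Fin m → ℝ) :
    x ⬝ᵥ (V *ᵥ x) ≤ hi * (x ⬝ᵥ x) := by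
  have hneg : EigenvaluesIn (-V) (-hi) (-lo) := by
    intro t ht
    obtain ⟨x, hx⟩ := ht.exists_hasEigenvector
    have hx1 : (-V) *ᵥ x = t • x := by simpa [Matrix.neg_mulVec] using Module.End.mem_eigenspace_iff.1 hx.1
    have := h (-t) (hasEigenvalue_of_mulVec hx.2 (by
      rw [neg_smul, ← hx1, Matrix.neg_mulVec, neg_neg]))
    constructor <;> linarith [this.1, this.2]
  have := hneg.le_dotProduct hV.neg x
  rw [Matrix.neg_mulVec, dotProduct_neg] at this
  linarith

lemma posDef (h : EigenvaluesIn V lo hi) (hlo : 0 < lo) (hV : V.IsHermitian) : V.PosDef := by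
  refine Matrix.PosDef.of_dotProduct_mulVec_pos hV fun x hx => ?_
  have h1 : 0 < x ⬝ᵥ x := by simpa using Matrix.dotProduct_star_self_pos_iff.2 hx
  exact (mul_pos hlo h1).trans_le (by simpa using h.le_dotProduct hV x)

/-- The squared norm of row `j` is the quadratic form of `A Aᵀ` at the `j`th basis vector. In this
form the singular value bound limits the linear term of each component of `L`. -/
lemma sum_sq_row_le {A : Matrix (Fin m) (Fin m) ℝ} (h : EigenvaluesIn (A * Aᵀ) lo hi)
    (j : Fin m) : ∑ k, A j k ^ 2 ≤ hi := by
  have := h.dotProduct_le (Matrix.isHermitian_mul_conjTranspose_self A) (Pi.single j 1)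
  simpa [Matrix.mul_apply, sq] using this

end EigenvaluesIn

section InvSqrt

variable {m : ℕ} {V : Matrix (Fin m) (Fin m) ℝ}

lemma isUnit_cfcSqrt (hV : V.PosDef) : IsUnit (CFC.sqrt V) := by
  have h := CFC.sqrt_mul_sqrt_self V (Matrix.nonneg_iff_posSemidef.2 hV.posSemidef)
  exact isUnit_of_mul_isUnit_left (h ▸ hV.isUnit)

lemma transpose_invSqrt (V : Matrix (Fin m) (Fin m) ℝ) : (invSqrt V)ᵀ = invSqrt V := by
  have h : (CFC.sqrt V)ᵀ = CFC.sqrt V := by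
    have := (IsSelfAdjoint.of_nonneg (CFC.sqrt_nonneg V)).star_eq
    rwa [Matrix.star_eq_conjTranspose, Matrix.conjTranspose_eq_transpose_of_trivial] at this
  rw [invSqrt, Matrix.transpose_nonsing_inv, h]

lemma invSqrt_mul_mul_invSqrt (hV : V.PosDef) : invSqrt V * V * invSqrt V = 1 := by
  have h := CFC.sqrt_mul_sqrt_self V (Matrix.nonneg_iff_posSemidef.2 hV.posSemidef)
  have hdet := (Matrix.isUnit_iff_isUnit_det _).1 (isUnit_cfcSqrt hV)
  rw [invSqrt]
  nth_rewrite 2 [← h]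
  rw [← Matrix.mul_assoc, Matrix.nonsing_inv_mul _ hdet, Matrix.one_mul,
    Matrix.mul_nonsing_inv _ hdet]

/-- For `V` the covariance of the score, this makes the projection of the score on `V^{-1/2} v` have
variance `vᵀv`. -/
lemma invSqrt_mulVec_quadForm (hV : V.PosDef) (v : Fin m → ℝ) :
    (invSqrt V *ᵥ v) ⬝ᵥ (V *ᵥ (invSqrt V *ᵥ v)) = v ⬝ᵥ v := by
  have : (invSqrt V *ᵥ v) = v ᵥ* invSqrt V := by
    rw [← Matrix.mulVec_transpose, transpose_invSqrt]
  nth_rewrite 1 [this]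
  rw [← Matrix.dotProduct_mulVec, Matrix.mulVec_mulVec, Matrix.mulVec_mulVec,
    invSqrt_mul_mul_invSqrt hV, Matrix.one_mulVec]

end InvSqrt

/-! ### The measurement error model -/

namespace MEModel

variable {𝒳 𝒵 𝒲 𝒴 : Type*} [MeasurableSpace 𝒳] [MeasurableSpace 𝒵]
  [MeasurableSpace 𝒲] [MeasurableSpace 𝒴] {d : ℕ}

/-- Under the true parameter the locally efficient score has mean zero, since its conditional mean
given `(X, Z)` vanishes. -/
lemma integral_effScore_eq_zero (M : MEModel 𝒳 𝒵 𝒲 𝒴 d)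
    {a : EuclideanSpace ℝ (Fin d) → 𝒳 → 𝒵 → EuclideanSpace ℝ (Fin d)}
    (ha : M.SolvesIntegralEq a) {β : EuclideanSpace ℝ (Fin d)}
    (hint : Integrable (fun o => M.effScore a o β) (M.obsLaw β)) :
    ∫ o, M.effScore a o β ∂(M.obsLaw β) = 0 := by
  have := M.sigmaFinite_nuW
  have := M.sigmaFinite_nuY
  have := M.isProbabilityMeasure_lawXZ
  set f : (𝒳 × 𝒵) × (𝒲 × 𝒴) → ℝ := fun t =>
    M.pW t.2.1 t.1.1 t.1.2 * M.pY t.2.2 t.1.1 t.1.2 β with hf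
  have hf0 : ∀ t, 0 ≤ f t := fun t => mul_nonneg (M.pW_nonneg _ _ _) (M.pY_nonneg _ _ _ _)
  have hfm : Measurable f :=
    (M.measurable_pW.comp (g := fun t : 𝒲 × 𝒳 × 𝒵 => M.pW t.1 t.2.1 t.2.2)
      (f := fun t : (𝒳 × 𝒵) × (𝒲 × 𝒴) => (t.2.1, t.1.1, t.1.2)) (by fun_prop)).mul
    ((M.measurable_pY β).comp (f := fun t : (𝒳 × 𝒵) × (𝒲 × 𝒴) => (t.2.2, t.1.1, t.1.2))
      (by fun_prop))
  have hproj : Measurable fun t : (𝒳 × 𝒵) × (𝒲 × 𝒴) => (t.2.1, t.1.2, t.2.2) := by fun_prop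
  have hint' := hint
  rw [obsLaw, integrable_map_measure hint.aestronglyMeasurable hproj.aemeasurable,
    integrable_withDensity_iff_integrable_smul' hfm.ennreal_ofReal (by simp)] at hint'
  have hae := hint.aestronglyMeasurable
  rw [obsLaw] at hae ⊢
  rw [integral_map hproj.aemeasurable hae,
    integral_withDensity_eq_integral_toReal_smul hfm.ennreal_ofReal (by simp)]
  -- By Fubini the inner integral, for fixed `(X, Z)`, is a difference of two conditional means,
  -- which the integral equation makes equal. Splitting it needs both integrands to be integrable.
  refine (integral_prod _ hint').trans ?_
  refine integral_eq_zero_of_ae ?_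
  filter_upwards [ha.condMean_exists β, ha.equation β] with t h1 h2
  have e : ∀ y : 𝒲 × 𝒴, (ENNReal.ofReal (f (t, y))).toReal • M.effScore a (y.1, t.2, y.2) β =
      M.condIntegrand β (M.score β) t.1 t.2 y -
        M.condIntegrand β (M.postMean β (a β)) t.1 t.2 y := fun y => by
    rw [ENNReal.toReal_ofReal (hf0 _), effScore, smul_sub]
    rfl
  refine (integral_congr_ae (ae_of_all _ e)).trans ?_
  rw [integral_sub h1.2 h1.1]
  exact sub_eq_zero.2 h2.symm

end MEModel

/-! ### Central limit theorem for triangular arrays -/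

/-- For `|x| ≤ 1` this is the remainder of the exponential series; for `|x| ≥ 1` every term is
itself at most a multiple of `|x|³`. The constant `4` covers both ranges and is not sharp. -/
lemma norm_exp_mul_I_sub_taylor_le (x : ℝ) :
    ‖Complex.exp (x * Complex.I) - (1 + x * Complex.I - x ^ 2 / 2)‖ ≤ 4 * |x| ^ 3 := by
  have hnorm : ‖(x : ℂ) * Complex.I‖ = |x| := by simp
  rcases le_total |x| 1 with h | h
  · have := Complex.exp_bound (x := x * Complex.I) (by rwa [hnorm]) (n := 3) (by norm_num)
    rw [hnorm] at this
    simp only [Finset.sum_range_succ, Finset.sum_range_zero] at this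
    have he : (0 + ((x : ℂ) * Complex.I) ^ 0 / (Nat.factorial 0 : ℕ)
        + ((x : ℂ) * Complex.I) ^ 1 / (Nat.factorial 1 : ℕ)
        + ((x : ℂ) * Complex.I) ^ 2 / (Nat.factorial 2 : ℕ)) =
        1 + x * Complex.I - (x : ℂ) ^ 2 / 2 := by
      simp [Nat.factorial, mul_pow, Complex.I_sq]
      ring
    rw [he] at this
    refine this.trans ?_
    have h3 : 0 ≤ |x| ^ 3 := by positivity
    norm_num [Nat.factorial]
    nlinarith
  · have h1 : ‖Complex.exp (x * Complex.I)‖ = 1 := Complex.norm_exp_ofReal_mul_I x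
    have h2 : ‖(1 : ℂ) + x * Complex.I - x ^ 2 / 2‖ ≤ 1 + |x| + |x| ^ 2 / 2 := by
      refine (norm_sub_le _ _).trans (add_le_add ((norm_add_le _ _).trans ?_) ?_)
      · rw [hnorm]; simp
      · simp
    refine (norm_sub_le _ _).trans ?_
    rw [h1]
    nlinarith [mul_nonneg (sub_nonneg.2 h) (sub_nonneg.2 h), sq_nonneg |x|,
      mul_nonneg (sq_nonneg |x|) (sub_nonneg.2 h), mul_nonneg (abs_nonneg x) (sub_nonneg.2 h)]

/-- Integrability of the lower powers from that of the fourth one. -/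
lemma integrable_pow_of_integrable_pow_four {ν : Measure ℝ} [IsProbabilityMeasure ν]
    (h4 : Integrable (fun x : ℝ => x ^ 4) ν) {k : ℕ} (hk : k ≤ 4) :
    Integrable (fun x : ℝ => |x| ^ k) ν := by
  refine ((integrable_const (1 : ℝ)).add h4).mono' (by fun_prop) (ae_of_all _ fun x => ?_)
  simp only [Pi.add_apply, norm_pow, Real.norm_eq_abs, abs_abs]
  have hx4 : x ^ 4 = |x| ^ 4 := by rw [← abs_pow, abs_of_nonneg (by positivity)]
  rw [hx4]
  rcases le_total |x| 1 with h | h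
  · exact (pow_le_one₀ (abs_nonneg x) h).trans (by have := pow_nonneg (abs_nonneg x) 4; linarith)
  · exact (pow_le_pow_right₀ h hk).trans (by linarith)

/-- Second order expansion of the characteristic function with a fourth moment remainder. -/
lemma norm_charFun_sub_le {ν : Measure ℝ} [IsProbabilityMeasure ν]
    (h0 : ∫ x, x ∂ν = 0) (h1 : ∫ x, x ^ 2 ∂ν = 1) (h4 : Integrable (fun x : ℝ => x ^ 4) ν) (s : ℝ) :
    ‖charFun ν s - (1 - (s : ℂ) ^ 2 / 2)‖ ≤ 4 * |s| ^ 3 * √(∫ x, x ^ 4 ∂ν + 1) := by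
  set m := ∫ x, x ^ 4 ∂ν with hm
  have hm0 : 0 ≤ m := integral_nonneg fun x => by positivity
  have i1 : Integrable (fun x : ℝ => x) ν := by
    rw [← integrable_norm_iff (by fun_prop)]
    simpa using integrable_pow_of_integrable_pow_four h4 (k := 1) (by norm_num)
  have i2 : Integrable (fun x : ℝ => x ^ 2) ν := by
    simpa using integrable_pow_of_integrable_pow_four h4 (k := 2) (by norm_num)
  have i3 : Integrable (fun x : ℝ => |x| ^ 3) ν :=
    integrable_pow_of_integrable_pow_four h4 (by norm_num)
  have ie : Integrable (fun x : ℝ => Complex.exp (s * x * Complex.I)) ν := by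
    refine (integrable_const (1 : ℝ)).mono' (by fun_prop) (ae_of_all _ fun x => ?_)
    rw [← Complex.ofReal_mul, Complex.norm_exp_ofReal_mul_I]
  have it : Integrable (fun x : ℝ =>
      1 + ((s * x : ℝ) : ℂ) * Complex.I - ((s * x : ℝ) : ℂ) ^ 2 / 2) ν := by
    refine ((integrable_const _).add ?_).sub ?_
    · exact ((i1.const_mul s).ofReal).mul_const _
    · have := ((i2.const_mul (s ^ 2)).ofReal (𝕜 := ℂ)).div_const 2
      refine this.congr (ae_of_all _ fun x => ?_)
      simp [mul_pow]
  have hT : ∫ x, (1 + ((s * x : ℝ) : ℂ) * Complex.I - ((s * x : ℝ) : ℂ) ^ 2 / 2) ∂ν =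
      1 - (s : ℂ) ^ 2 / 2 := by
    have e : ∀ x : ℝ, (1 + ((s * x : ℝ) : ℂ) * Complex.I - ((s * x : ℝ) : ℂ) ^ 2 / 2) =
        1 + (s * Complex.I) * (x : ℂ) - ((s : ℂ) ^ 2 / 2) * ((x ^ 2 : ℝ) : ℂ) := fun x => by
      push_cast; ring
    simp_rw [e]
    rw [integral_sub, integral_add, integral_const_mul, integral_const_mul,
      integral_complex_ofReal, integral_complex_ofReal, h0, h1]
    · simp
    · exact integrable_const _
    · exact (i1.ofReal).const_mul _
    · exact (integrable_const _).add ((i1.ofReal).const_mul _)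
    · exact (i2.ofReal).const_mul _
  rw [charFun_apply_real, ← hT, ← integral_sub ie it]
  have h3 : ∫ x, |x| ^ 3 ∂ν ≤ √(m + 1) := by
    -- Weighted AM-GM, `|x|³ ≤ (c/2) x² + x⁴/(2c)`, integrates to `c/2 + m/(2c) ≤ c` for this `c`.
    -- The added `1` keeps `c` positive.
    set c := √(m + 1) with hc
    have hcpos : 0 < c := Real.sqrt_pos.2 (by linarith)
    have hc2 : c * c = m + 1 := Real.mul_self_sqrt (by linarith)
    have hle : ∫ x, |x| ^ 3 ∂ν ≤ ∫ x, (c / 2 * x ^ 2 + 1 / (2 * c) * x ^ 4) ∂ν := by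
      refine integral_mono i3 ((i2.const_mul _).add (h4.const_mul _)) fun x => ?_
      have : c / 2 * x ^ 2 + 1 / (2 * c) * x ^ 4 - |x| ^ 3 =
          |x| ^ 2 * (c - |x|) ^ 2 / (2 * c) := by
        have hx4 : x ^ 4 = |x| ^ 4 := by rw [← abs_pow, abs_of_nonneg (by positivity)]
        rw [hx4, ← sq_abs x]
        field_simp
        ring
      have h0 : 0 ≤ |x| ^ 2 * (c - |x|) ^ 2 / (2 * c) := by positivity
      simp only
      linarith
    refine hle.trans ?_
    rw [integral_add (i2.const_mul _) (h4.const_mul _), integral_const_mul, integral_const_mul, h1,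
      ← hm]
    have : 1 / (2 * c) * m ≤ c / 2 := by
      rw [div_mul_eq_mul_div, one_mul, div_le_iff₀ (by positivity)]
      nlinarith
    linarith
  calc _ ≤ ∫ x, 4 * |s| ^ 3 * |x| ^ 3 ∂ν := by
        refine norm_integral_le_of_norm_le (i3.const_mul _) (ae_of_all _ fun x => ?_)
        have := norm_exp_mul_I_sub_taylor_le (s * x)
        rw [abs_mul, mul_pow, ← mul_assoc] at this
        simpa using this
    _ = 4 * |s| ^ 3 * ∫ x, |x| ^ 3 ∂ν := integral_const_mul _ _
    _ ≤ _ := by gcongr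

/-- It suffices that `n (φ(t/√n) - 1) → -t²/2`. The remainder of the expansion, multiplied by `n`,
is `4 |t|³ √((m₄ + 1)/n)`, so the fourth moment `m₄` may grow as long as it is `o(n)`. -/
lemma tendsto_charFun_pow {ν : ℕ → Measure ℝ}
    (hν : ∀ᶠ n in atTop, IsProbabilityMeasure (ν n) ∧ ∫ x, x ∂(ν n) = 0 ∧ ∫ x, x ^ 2 ∂(ν n) = 1 ∧
      Integrable (fun x : ℝ => x ^ 4) (ν n))
    (h4 : Tendsto (fun n : ℕ => (∫ x, x ^ 4 ∂(ν n)) / n) atTop (𝓝 0)) (t : ℝ) :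
    Tendsto (fun n : ℕ => charFun (ν n) ((√(n : ℝ))⁻¹ * t) ^ n) atTop
      (𝓝 (Complex.exp (-(t : ℂ) ^ 2 / 2))) := by
  have key : Tendsto (fun n : ℕ => (n : ℂ) * (charFun (ν n) ((√(n : ℝ))⁻¹ * t) - 1)) atTop
      (𝓝 (-(t : ℂ) ^ 2 / 2)) := by
    have hlim : Tendsto (fun n : ℕ => 4 * |t| ^ 3 * √((∫ x, x ^ 4 ∂(ν n)) / n + 1 / n)) atTop
        (𝓝 0) := by
      have := ((h4.add tendsto_one_div_atTop_nhds_zero_nat).sqrt).const_mul (4 * |t| ^ 3)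
      simpa using this
    rw [tendsto_iff_norm_sub_tendsto_zero]
    refine squeeze_zero' (Eventually.of_forall fun _ => norm_nonneg _) ?_ hlim
    filter_upwards [hν, eventually_gt_atTop 0] with n hn hn0
    obtain ⟨hp, h0, h1, hi⟩ := hn
    have hnpos : (0 : ℝ) < n := by exact_mod_cast hn0
    have h := norm_charFun_sub_le h0 h1 hi ((√(n : ℝ))⁻¹ * t)
    have hs : (((√(n : ℝ))⁻¹ * t : ℝ) : ℂ) ^ 2 = (t : ℂ) ^ 2 / n := by
      rw [← Complex.ofReal_pow, mul_pow, inv_pow, Real.sq_sqrt hnpos.le]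
      push_cast
      rw [div_eq_inv_mul]
    rw [hs] at h
    have hnC : (n : ℂ) ≠ 0 := by exact_mod_cast hn0.ne'
    have e : (n : ℂ) * (charFun (ν n) ((√(n : ℝ))⁻¹ * t) - 1) - -(t : ℂ) ^ 2 / 2 =
        (n : ℂ) * (charFun (ν n) ((√(n : ℝ))⁻¹ * t) - (1 - (t : ℂ) ^ 2 / n / 2)) := by
      field_simp
      ring
    rw [e, norm_mul, Complex.norm_natCast]
    refine (mul_le_mul_of_nonneg_left h hnpos.le).trans (le_of_eq ?_)
    rw [abs_mul, mul_pow, abs_of_nonneg (by positivity : 0 ≤ (√(n : ℝ))⁻¹), ← add_div,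
      Real.sqrt_div' _ hnpos.le]
    have hsq : √(n : ℝ) ^ 2 = n := Real.sq_sqrt hnpos.le
    have hspos : 0 < √(n : ℝ) := Real.sqrt_pos.2 hnpos
    nth_rewrite 1 [← hsq]
    field_simp
  have := Complex.tendsto_one_add_pow_exp_of_tendsto key
  simpa using this

lemma norm_exp_mul_I_sub_exp_mul_I_le (x y : ℝ) :
    ‖Complex.exp (x * Complex.I) - Complex.exp (y * Complex.I)‖ ≤ |x - y| := by
  have h : Complex.exp (x * Complex.I) - Complex.exp (y * Complex.I) =
      Complex.exp (y * Complex.I) * (Complex.exp (Complex.I * (x - y : ℝ)) - 1) := by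
    rw [mul_sub, ← Complex.exp_add, mul_one]
    congr 2
    push_cast
    ring
  rw [h, norm_mul, Complex.norm_exp_ofReal_mul_I, one_mul]
  exact Real.norm_exp_I_mul_ofReal_sub_one_le

/-- Where `|X - Y| < ε` the exponentials differ by at most `|t| ε`, elsewhere by at most `2`. This
plays the role of Slutsky's theorem when the probability space changes with `n`. -/
lemma norm_charFun_map_sub_le {Ω : Type*} [MeasurableSpace Ω] {μ : Measure Ω}
    [IsProbabilityMeasure μ] {X Y : Ω → ℝ} (hX : AEMeasurable X μ) (hY : AEMeasurable Y μ)
    {ε : ℝ} (hε : 0 ≤ ε) (t : ℝ) :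
    ‖charFun (μ.map X) t - charFun (μ.map Y) t‖ ≤
      |t| * ε + 2 * μ.real {ω | ε ≤ |X ω - Y ω|} := by
  have e : ∀ {Z : Ω → ℝ}, AEMeasurable Z μ → charFun (μ.map Z) t =
      ∫ ω, Complex.exp ((t * Z ω : ℝ) * Complex.I) ∂μ := fun {Z} hZ => by
    rw [charFun_apply_real, integral_map hZ (by fun_prop)]
    simp
  have hint : ∀ {Z : Ω → ℝ}, AEMeasurable Z μ →
      Integrable (fun ω => Complex.exp ((t * Z ω : ℝ) * Complex.I)) μ := fun {Z} hZ => by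
    refine (integrable_const (1 : ℝ)).mono' ?_ (ae_of_all _ fun x => ?_)
    · exact (Measurable.comp_aemeasurable (g := fun z : ℝ => Complex.exp ((t * z : ℝ) * Complex.I))
        (by fun_prop) hZ).aestronglyMeasurable
    · rw [Complex.norm_exp_ofReal_mul_I]
  rw [e hX, e hY, ← integral_sub (hint hX) (hint hY)]
  set s := {ω | ε ≤ |X ω - Y ω|} with hs
  have hsm : NullMeasurableSet s μ :=
    nullMeasurableSet_le aemeasurable_const
      (continuous_abs.measurable.comp_aemeasurable (hX.sub hY))
  have hind : Integrable (s.indicator fun _ => (2 : ℝ)) μ :=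
    (integrable_const _).indicator₀ hsm
  calc _ ≤ ∫ ω, (|t| * ε + s.indicator (fun _ => (2 : ℝ)) ω) ∂μ := by
        refine norm_integral_le_of_norm_le ((integrable_const _).add hind)
          (ae_of_all _ fun ω => ?_)
        by_cases hω : ω ∈ s
        · rw [Set.indicator_of_mem hω]
          refine (norm_sub_le _ _).trans ?_
          rw [Complex.norm_exp_ofReal_mul_I, Complex.norm_exp_ofReal_mul_I]
          have : 0 ≤ |t| * ε := by positivity
          linarith
        · rw [Set.indicator_of_notMem hω, add_zero]
          refine (norm_exp_mul_I_sub_exp_mul_I_le _ _).trans ?_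
          rw [← mul_sub, abs_mul]
          gcongr
          exact (not_le.1 hω).le
    _ = _ := by
        rw [integral_add (integrable_const _) hind, integral_indicator₀ hsm]
        simp [mul_comm]

/-- Central limit theorem for a triangular array of rowwise i.i.d. standardized variables under a
fourth moment condition, up to a remainder that vanishes in probability. -/
theorem tendstoInDistribution_of_sub_iid_sum {Ω : ℕ → Type*} [∀ n, MeasurableSpace (Ω n)]
    (μ : ∀ n, Measure (Ω n)) [∀ n, IsProbabilityMeasure (μ n)]
    {T : ∀ n, Ω n → ℝ} (hT : ∀ n, AEMeasurable (T n) (μ n))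
    {ξ : ∀ n, Fin n → Ω n → ℝ} {ν : ℕ → Measure ℝ}
    (hξ : ∀ᶠ n in atTop, (∀ i, HasLaw (ξ n i) (ν n) (μ n)) ∧ iIndepFun (ξ n) (μ n))
    (hν : ∀ᶠ n in atTop, IsProbabilityMeasure (ν n) ∧ ∫ x, x ∂(ν n) = 0 ∧ ∫ x, x ^ 2 ∂(ν n) = 1 ∧
      Integrable (fun x : ℝ => x ^ 4) (ν n))
    (h4 : Tendsto (fun n : ℕ => (∫ x, x ^ 4 ∂(ν n)) / n) atTop (𝓝 0))
    (hsub : ∀ ε > 0, Tendsto (fun n : ℕ => μ n {ω | ε ≤ |T n ω - (√(n : ℝ))⁻¹ * ∑ i, ξ n i ω|})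
      atTop (𝓝 0)) :
    TendstoInDistribution T atTop (id : ℝ → ℝ) μ (gaussianReal 0 1) where
  forall_aemeasurable := hT
  aemeasurable_limit := aemeasurable_id
  tendsto := by
    refine ProbabilityMeasure.tendsto_iff_tendsto_charFun.2 fun t ↦ ?_
    simp only [ProbabilityMeasure.coe_mk, Measure.map_id, charFun_gaussianReal]
    have hG : Complex.exp (t * ((0 : ℝ) : ℂ) * Complex.I - (((1 : NNReal) : ℝ) : ℂ) * t ^ 2 / 2) =
        Complex.exp (-(t : ℂ) ^ 2 / 2) := by
      congr 1
      push_cast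
      ring
    rw [hG]
    have hS : Tendsto (fun n : ℕ => charFun ((μ n).map fun ω => (√(n : ℝ))⁻¹ * ∑ i, ξ n i ω) t)
        atTop (𝓝 (Complex.exp (-(t : ℂ) ^ 2 / 2))) := by
      refine (tendsto_charFun_pow hν h4 t).congr' ?_
      filter_upwards [hξ] with n hn
      have hm : ∀ i, AEMeasurable (ξ n i) (μ n) := fun i => (hn.1 i).aemeasurable
      rw [charFun_map_mul_comp (Finset.aemeasurable_fun_sum _ fun i _ => hm i),
        hn.2.charFun_map_fun_sum_eq_prod hm]
      simp [fun i => (hn.1 i).map_eq]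
    have hD : Tendsto (fun n : ℕ => charFun ((μ n).map (T n)) t -
        charFun ((μ n).map fun ω => (√(n : ℝ))⁻¹ * ∑ i, ξ n i ω) t) atTop (𝓝 0) := by
      rw [Metric.tendsto_nhds]
      intro η hη
      -- With this threshold the Lipschitz part is at most `η / 2`, also when `t = 0`; the
      -- exceptional event, of probability below `η / 4`, accounts for the other half.
      have hε : 0 < η / (2 * (|t| + 1)) := by positivity
      have hreal : Tendsto (fun n : ℕ => (μ n).real
          {ω | η / (2 * (|t| + 1)) ≤ |T n ω - (√(n : ℝ))⁻¹ * ∑ i, ξ n i ω|}) atTop (𝓝 0) := by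
        simpa [Measure.real, Function.comp_def] using (ENNReal.tendsto_toReal ENNReal.zero_ne_top).comp (hsub _ hε)
      filter_upwards [hreal.eventually_lt_const (show (0 : ℝ) < η / 4 by positivity), hξ]
        with n hn hξn
      have hm : ∀ i, AEMeasurable (ξ n i) (μ n) := fun i => (hξn.1 i).aemeasurable
      rw [dist_zero_right]
      refine (norm_charFun_map_sub_le (hT n)
        ((Finset.aemeasurable_fun_sum _ fun i _ => hm i).const_mul _) hε.le t).trans_lt ?_
      have : |t| * (η / (2 * (|t| + 1))) ≤ η / 2 := by
        rw [mul_div_assoc', div_le_div_iff₀ (by positivity) (by positivity)]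
        nlinarith [abs_nonneg t]
      linarith
    simpa using hD.add hS

/-! ### Sums over an i.i.d. sample -/

section Sample

variable {Ω 𝒪 : Type*} [MeasurableSpace Ω] [MeasurableSpace 𝒪] {μ : Measure Ω}
  {P : Measure 𝒪} {n : ℕ} {O : Fin n → Ω → 𝒪}

lemma memLp_comp_hasLaw {X : Ω → 𝒪} (hX : HasLaw X P μ) {f : 𝒪 → ℝ} {q : ENNReal}
    (hf : MemLp f q P) : MemLp (fun ω => f (X ω)) q μ := by
  rw [← hX.map_eq] at hf
  exact hf.comp_of_map hX.aemeasurable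

lemma iIndepFun_comp_hasLaw {𝒯 : Type*} [MeasurableSpace 𝒯] (hO : ∀ i, HasLaw (O i) P μ)
    (hind : iIndepFun O μ) {f : 𝒪 → 𝒯} (hf : AEMeasurable f P) :
    iIndepFun (fun i ω => f (O i ω)) μ :=
  hind.comp₀ (fun _ => f) (fun i => (hO i).aemeasurable) (fun i => by rwa [(hO i).map_eq])

variable [IsProbabilityMeasure μ]

lemma integrable_sq_iid_sum_sub (hO : ∀ i, HasLaw (O i) P μ) {f : 𝒪 → ℝ} (hf : MemLp f 2 P)
    (c : ℝ) : Integrable (fun ω => (∑ i, f (O i ω) - c) ^ 2) μ :=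
  ((memLp_finsetSum _ fun i _ => memLp_comp_hasLaw (hO i) hf).sub (memLp_const c)).integrable_sq

/-- The variance of an i.i.d. sum is at most `n` times the second moment. -/
lemma integral_sq_iid_sum_sub_le (hO : ∀ i, HasLaw (O i) P μ) (hind : iIndepFun O μ)
    {f : 𝒪 → ℝ} (hf : MemLp f 2 P) :
    ∫ ω, (∑ i, f (O i ω) - n * ∫ o, f o ∂P) ^ 2 ∂μ ≤ n * ∫ o, f o ^ 2 ∂P := by
  have hL : ∀ i, MemLp (fun ω => f (O i ω)) 2 μ := fun i => memLp_comp_hasLaw (hO i) hf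
  have hi := iIndepFun_comp_hasLaw hO hind hf.aemeasurable
  have hmean : ∀ i, ∫ ω, f (O i ω) ∂μ = ∫ o, f o ∂P := fun i =>
    (hO i).integral_comp hf.aestronglyMeasurable
  have hsum : ∫ ω, ∑ i, f (O i ω) ∂μ = n * ∫ o, f o ∂P := by
    rw [integral_finsetSum _ fun i _ => (hL i).integrable (by norm_num)]
    simp [hmean]
  have hvar : Var[∑ i, fun ω => f (O i ω); μ] = ∑ i, Var[fun ω => f (O i ω); μ] :=
    IndepFun.variance_sum (fun i _ => hL i) fun i _ j _ hij => hi.indepFun hij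
  have hfun : (∑ i, fun ω => f (O i ω)) = fun ω => ∑ i, f (O i ω) := by
    ext ω; simp
  rw [hfun, variance_eq_integral (Finset.aemeasurable_fun_sum _ fun i _ => (hL i).aemeasurable),
    hsum] at hvar
  rw [hvar]
  calc _ ≤ ∑ _i : Fin n, ∫ o, f o ^ 2 ∂P := by
        refine Finset.sum_le_sum fun i _ => ?_
        refine (variance_le_expectation_sq (hL i).aestronglyMeasurable).trans (le_of_eq ?_)
        exact (hO i).integral_comp (f := fun o => f o ^ 2) (hf.aestronglyMeasurable.pow 2)
    _ = _ := by simp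

/-- Markov's inequality for a random variable with values in `[0, ∞)`. -/
lemma measure_lt_le_of_integral_le {Q : Ω → ℝ} (hQ0 : ∀ ω, 0 ≤ Q ω) (hQ : Integrable Q μ)
    {c s M : ℝ} (hs : 0 < s) (hM : 0 < M) (hc : ∫ ω, Q ω ∂μ ≤ c * s) :
    μ {ω | M * s < Q ω} ≤ ENNReal.ofReal (c / M) := by
  have h := mul_meas_ge_le_integral_of_nonneg (ae_of_all _ hQ0) hQ (M * s)
  have h2 : μ.real {ω | M * s ≤ Q ω} ≤ c / M := by
    rw [le_div_iff₀ hM]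
    have := h.trans hc
    have h3 : (μ.real {ω | M * s ≤ Q ω} * M) * s ≤ c * s := by linarith
    exact le_of_mul_le_mul_right h3 hs
  calc μ {ω | M * s < Q ω} ≤ μ {ω | M * s ≤ Q ω} := measure_mono <| Set.ofPred_subset_ofPred.2 fun ω => le_of_lt
    _ = ENNReal.ofReal (μ.real {ω | M * s ≤ Q ω}) := by simp
    _ ≤ _ := ENNReal.ofReal_le_ofReal h2

end Sample

/-- The random field `L`, a sum of `n` estimating functions, is of the order of its stochastic
fluctuations at `β₀` and is close in the ball of radius `r` to the affine function with slope
`n A + T`, where the Frobenius norm of `T` is `O(√n d)`. -/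
def LinearizesAt {d : ℕ} (L : EuclideanSpace ℝ (Fin d) → EuclideanSpace ℝ (Fin d))
    (A : Matrix (Fin d) (Fin d) ℝ) (β₀ : EuclideanSpace ℝ (Fin d)) (n : ℕ) (r M : ℝ) : Prop :=
  ∑ j, L β₀ j ^ 2 ≤ M * (n * d) ∧
  ∃ T : Matrix (Fin d) (Fin d) ℝ, ∑ j, ∑ k, T j k ^ 2 ≤ M * (n * d ^ 2) ∧
    ∀ β ∈ Metric.ball β₀ r, ∀ j,
      |L β j - L β₀ j - n * ∑ k, A j k * (β - β₀) k - ∑ k, T j k * (β - β₀) k| ≤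
        M * n * (d * ‖β - β₀‖ ^ 2)

/-- A sum of i.i.d. smooth estimating functions with bounded moments is close to its linearization
with high probability. -/
lemma measure_not_linearizesAt_le {Ω 𝒪 : Type*} [MeasurableSpace Ω] [MeasurableSpace 𝒪]
    {μ : Measure Ω} [IsProbabilityMeasure μ] {P : Measure 𝒪} {n d : ℕ} (hn : 0 < n) (hd : 0 < d)
    {O : Fin n → Ω → 𝒪} (hO : ∀ i, HasLaw (O i) P μ) (hind : iIndepFun O μ)
    {S : 𝒪 → EuclideanSpace ℝ (Fin d) → EuclideanSpace ℝ (Fin d)}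
    {β₀ : EuclideanSpace ℝ (Fin d)} {A : Matrix (Fin d) (Fin d) ℝ} {B : 𝒪 → ℝ} {r c M : ℝ}
    (hM : 0 < M)
    (hS : ∀ j, MemLp (fun o => S o β₀ j) 2 P) (hS0 : ∀ j, ∫ o, S o β₀ j ∂P = 0)
    (hS2 : ∀ j, ∫ o, S o β₀ j ^ 2 ∂P ≤ c)
    (hD : ∀ j k, MemLp (fun o => (fderiv ℝ (S o) β₀ (EuclideanSpace.single k 1)) j) 2 P)
    (hDA : ∀ j k, ∫ o, (fderiv ℝ (S o) β₀ (EuclideanSpace.single k 1)) j ∂P = A j k)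
    (hD2 : ∀ j k, ∫ o, (fderiv ℝ (S o) β₀ (EuclideanSpace.single k 1)) j ^ 2 ∂P ≤ c)
    (hB : MemLp B 2 P) (hB2 : ∫ o, B o ^ 2 ∂P ≤ c)
    (hSB : ∀ᵐ o ∂P, ∀ β ∈ Metric.ball β₀ r, DifferentiableAt ℝ (S o) β ∧
      DifferentiableAt ℝ (fderiv ℝ (S o)) β ∧
      ∀ j k l, |(fderiv ℝ (fderiv ℝ (S o)) β
        (EuclideanSpace.single k 1) (EuclideanSpace.single l 1)) j| ≤ B o) :
    μ {ω | ¬ LinearizesAt (fun β => ∑ i, S (O i ω) β) A β₀ n r M} ≤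
      3 * ENNReal.ofReal ((c + 1) / M) := by
  have hnR : (0 : ℝ) < n := by exact_mod_cast hn
  have hdR : (0 : ℝ) < d := by exact_mod_cast hd
  have : IsProbabilityMeasure P := (hO ⟨0, hn⟩).isProbabilityMeasure_iff.1 inferInstance
  set D : Fin d → Fin d → 𝒪 → ℝ := fun j k o =>
    (fderiv ℝ (S o) β₀ (EuclideanSpace.single k 1)) j with hDdef
  -- `Q₁` is the squared norm of `L(β₀)`, `Q₂` the squared Frobenius norm of the centred derivative
  -- sum, `Q₃` the total of the dominating functions. Markov's inequality for each gives the factor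
  -- `3`.
  set Q₁ : Ω → ℝ := fun ω => ∑ j, (∑ i, S (O i ω) β₀ j - 0) ^ 2 with hQ₁
  set Q₂ : Ω → ℝ := fun ω => ∑ j, ∑ k, (∑ i, D j k (O i ω) - n * A j k) ^ 2 with hQ₂
  set Q₃ : Ω → ℝ := fun ω => ∑ i, |B (O i ω)| with hQ₃
  have b₁ : μ {ω | M * (n * d) < Q₁ ω} ≤ ENNReal.ofReal ((c + 1) / M) := by
    refine measure_lt_le_of_integral_le (fun ω => by positivity)
      (integrable_finsetSum _ fun j _ => integrable_sq_iid_sum_sub hO (hS j) 0) (by positivity)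
      hM ?_
    rw [integral_finsetSum _ fun j _ => integrable_sq_iid_sum_sub hO (hS j) 0]
    calc _ ≤ ∑ _j : Fin d, n * c := by
          refine Finset.sum_le_sum fun j _ => ?_
          have := integral_sq_iid_sum_sub_le hO hind (hS j)
          rw [hS0 j, mul_zero] at this
          exact this.trans (mul_le_mul_of_nonneg_left (hS2 j) hnR.le)
      _ = c * (n * d) := by simp; ring
      _ ≤ _ := by gcongr; linarith
  have b₂ : μ {ω | M * (n * d ^ 2) < Q₂ ω} ≤ ENNReal.ofReal ((c + 1) / M) := by
    have hi : ∀ j k, Integrable (fun ω => (∑ i, D j k (O i ω) - n * A j k) ^ 2) μ := fun j k =>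
      integrable_sq_iid_sum_sub hO (hD j k) _
    refine measure_lt_le_of_integral_le (fun ω => by positivity)
      (integrable_finsetSum _ fun j _ => integrable_finsetSum _ fun k _ => hi j k) (by positivity)
      hM ?_
    rw [integral_finsetSum _ fun j _ => integrable_finsetSum _ fun k _ => hi j k]
    calc _ ≤ ∑ _j : Fin d, ∑ _k : Fin d, n * c := by
          refine Finset.sum_le_sum fun j _ => ?_
          rw [integral_finsetSum _ fun k _ => hi j k]
          refine Finset.sum_le_sum fun k _ => ?_
          have := integral_sq_iid_sum_sub_le hO hind (hD j k)
          rw [hDA j k] at this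
          exact this.trans (mul_le_mul_of_nonneg_left (hD2 j k) hnR.le)
      _ = c * (n * d ^ 2) := by simp; ring
      _ ≤ _ := by gcongr; linarith
  have b₃ : μ {ω | M * n < Q₃ ω} ≤ ENNReal.ofReal ((c + 1) / M) := by
    have hBi : Integrable (fun o => |B o|) P := (hB.integrable (by norm_num)).abs
    have hi : ∀ i, Integrable (fun ω => |B (O i ω)|) μ := fun i =>
      ((memLp_comp_hasLaw (hO i) hB).integrable (by norm_num)).abs
    refine measure_lt_le_of_integral_le (fun ω => by positivity)
      (integrable_finsetSum _ fun i _ => hi i) hnR hM ?_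
    rw [integral_finsetSum _ fun i _ => hi i]
    -- The first moment is bounded through `|B| ≤ B² + 1`, the source of the `+ 1` in `c + 1`.
    have hBc : ∫ o, |B o| ∂P ≤ c + 1 := by
      calc _ ≤ ∫ o, (B o ^ 2 + 1) ∂P := by
            refine integral_mono hBi (hB.integrable_sq.add (integrable_const _)) fun o => ?_
            simp only
            nlinarith [sq_abs (B o), sq_nonneg (|B o| - 1), abs_nonneg (B o)]
        _ = ∫ o, B o ^ 2 ∂P + 1 := by
            rw [integral_add hB.integrable_sq (integrable_const _)]; simp
        _ ≤ _ := by linarith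
    calc _ = ∑ _i : Fin n, ∫ o, |B o| ∂P := by
          refine Finset.sum_congr rfl fun i _ => ?_
          exact (hO i).integral_comp (f := fun o => |B o|) hBi.aestronglyMeasurable
      _ = n * ∫ o, |B o| ∂P := by simp
      _ ≤ _ := by rw [mul_comm]; gcongr
  have hae : ∀ᵐ ω ∂μ, ∀ i, ∀ β ∈ Metric.ball β₀ r, DifferentiableAt ℝ (S (O i ω)) β ∧
      DifferentiableAt ℝ (fderiv ℝ (S (O i ω))) β ∧
      ∀ j k l, |(fderiv ℝ (fderiv ℝ (S (O i ω))) β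
        (EuclideanSpace.single k 1) (EuclideanSpace.single l 1)) j| ≤ B (O i ω) := by
    rw [ae_all_iff]
    intro i
    have h := hSB
    rw [← (hO i).map_eq] at h
    exact ae_of_ae_map (hO i).aemeasurable h
  have hsub : {ω | ¬ LinearizesAt (fun β => ∑ i, S (O i ω) β) A β₀ n r M} ⊆
      ((({ω | M * (n * d) < Q₁ ω} ∪ {ω | M * (n * d ^ 2) < Q₂ ω}) ∪ {ω | M * n < Q₃ ω}) ∪
      {ω | ¬ ∀ i, ∀ β ∈ Metric.ball β₀ r, DifferentiableAt ℝ (S (O i ω)) β ∧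
      DifferentiableAt ℝ (fderiv ℝ (S (O i ω))) β ∧
      ∀ j k l, |(fderiv ℝ (fderiv ℝ (S (O i ω))) β
        (EuclideanSpace.single k 1) (EuclideanSpace.single l 1)) j| ≤ B (O i ω)}) := by
    intro ω hω
    by_contra hcon
    simp only [Set.mem_union, Set.mem_ofPred_eq, not_or, not_lt, not_not] at hcon
    obtain ⟨⟨⟨h1, h2⟩, h3⟩, h4⟩ := hcon
    refine hω ⟨?_, Matrix.of fun j k => ∑ i, D j k (O i ω) - n * A j k, ?_, ?_⟩
    · simpa [hQ₁] using h1
    · simpa [hQ₂] using h2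
    · intro β hβ j
      have hi := fun i => abs_taylor_two_le hβ (h4 i) j
      have e : (∑ i, S (O i ω) β) j - (∑ i, S (O i ω) β₀) j - n * ∑ k, A j k * (β - β₀) k -
          ∑ k, (Matrix.of fun j k => ∑ i, D j k (O i ω) - n * A j k) j k * (β - β₀) k =
          ∑ i, (S (O i ω) β j - S (O i ω) β₀ j - ∑ k, D j k (O i ω) * (β - β₀) k) := by
        simp only [Matrix.of_apply, Finset.sum_sub_distrib, sub_mul, Finset.sum_mul,
          Finset.mul_sum, WithLp.ofLp_sum, Finset.sum_apply]
        rw [Finset.sum_comm (s := (Finset.univ : Finset (Fin n)))]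
        simp only [mul_assoc]
        ring
      simp only
      rw [e]
      refine (Finset.abs_sum_le_sum_abs _ _).trans ((Finset.sum_le_sum fun i _ => hi i).trans ?_)
      rw [← Finset.sum_mul]
      gcongr
      exact (Finset.sum_le_sum fun i _ => le_abs_self _).trans h3
  refine (measure_mono hsub).trans ((measure_union_le _ _).trans ?_)
  rw [ae_iff.1 hae, add_zero]
  refine (measure_union_le _ _).trans ((add_le_add (measure_union_le _ _) le_rfl).trans ?_)
  calc _ ≤ ENNReal.ofReal ((c + 1) / M) + ENNReal.ofReal ((c + 1) / M) +
        ENNReal.ofReal ((c + 1) / M) := add_le_add (add_le_add b₁ b₂) b₃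
    _ = _ := by ring

/-! ### Roots of the penalized estimating equation -/

lemma abs_sum_mul_le_sqrt_mul_sqrt {ι : Type*} (s : Finset ι) (f g : ι → ℝ) {a b : ℝ}
    (hf : ∑ k ∈ s, f k ^ 2 ≤ a) (hg : ∑ k ∈ s, g k ^ 2 ≤ b) :
    |∑ k ∈ s, f k * g k| ≤ √a * √b := by
  have ha : 0 ≤ a := (Finset.sum_nonneg fun k _ => sq_nonneg (f k)).trans hf
  have hb : 0 ≤ b := (Finset.sum_nonneg fun k _ => sq_nonneg (g k)).trans hg
  rw [← Real.sqrt_mul ha]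
  refine Real.abs_le_sqrt ((Finset.sum_mul_sq_le_sq_mul_sq s f g).trans ?_)
  exact mul_le_mul hf hg (Finset.sum_nonneg fun k _ => sq_nonneg (g k)) ha

lemma abs_sum_mul_le_mul_norm {d : ℕ} (f : Fin d → ℝ) (x : EuclideanSpace ℝ (Fin d)) {a : ℝ}
    (hf : ∑ k, f k ^ 2 ≤ a) : |∑ k, f k * x k| ≤ √a * ‖x‖ := by
  have := abs_sum_mul_le_sqrt_mul_sqrt Finset.univ f (fun k => x k) hf
    (EuclideanSpace.real_norm_sq_eq x).symm.le
  rwa [Real.sqrt_sq (norm_nonneg _)] at this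

namespace LinearizesAt

variable {d n : ℕ} {L : EuclideanSpace ℝ (Fin d) → EuclideanSpace ℝ (Fin d)}
  {A : Matrix (Fin d) (Fin d) ℝ} {β₀ β : EuclideanSpace ℝ (Fin d)} {r M K hi : ℝ}

/-- In a ball of radius `O(√(d / n))` the fluctuation part of the linearization is negligible. -/
lemma abs_sub_linear_le (h : LinearizesAt L A β₀ n r M) (hM : 0 ≤ M) (hn : 0 < n) (hd : 0 < d)
    (hβ : ‖β - β₀‖ ≤ K * √((d : ℝ) / n)) (hr : K * √((d : ℝ) / n) < r) (j : Fin d) :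
    |L β j - L β₀ j - n * ∑ k, A j k * (β - β₀) k| ≤ (√M * K + M * K ^ 2) * d ^ 2 := by
  obtain ⟨-, T, hT, hlin⟩ := h
  have hnR : (0 : ℝ) < n := by exact_mod_cast hn
  have hdR : (1 : ℝ) ≤ d := by exact_mod_cast hd
  set s := √((d : ℝ) / n) with hs
  have hspos : 0 < s := Real.sqrt_pos.2 (by positivity)
  have hs2 : n * s ^ 2 = d := by
    rw [hs, Real.sq_sqrt (by positivity)]; field_simp
  have hK : 0 ≤ K := by
    by_contra hK
    have := (norm_nonneg (β - β₀)).trans hβ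
    nlinarith
  have h1 := hlin β (by rw [mem_ball_iff_norm]; exact hβ.trans_lt hr) j
  -- A row of `T` has norm at most `√(M n) d`, so its contribution is `√M K d^{3/2}`; it is rounded
  -- up to the order `d²` of the quadratic remainder.
  have h2 : |∑ k, T j k * (β - β₀) k| ≤ √M * K * d ^ 2 := by
    have hrow : ∑ k, T j k ^ 2 ≤ M * (n * d ^ 2) :=
      (Finset.single_le_sum (f := fun j => ∑ k, T j k ^ 2)
        (fun j _ => Finset.sum_nonneg fun k _ => sq_nonneg _) (Finset.mem_univ j)).trans hT
    calc _ ≤ √(M * (n * d ^ 2)) * ‖β - β₀‖ := abs_sum_mul_le_mul_norm _ _ hrow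
      _ ≤ √(M * (n * d ^ 2)) * (K * s) := by gcongr
      _ = √M * K * d * (√n * s) := by
          rw [Real.sqrt_mul hM, Real.sqrt_mul hnR.le, Real.sqrt_sq (by positivity)]; ring
      _ ≤ √M * K * d * d := by
          gcongr
          refine abs_le_of_sq_le_sq' ?_ (by positivity) |>.2
          rw [mul_pow, Real.sq_sqrt hnR.le, hs2]
          nlinarith
      _ = _ := by ring
  have h3 : M * n * (d * ‖β - β₀‖ ^ 2) ≤ M * K ^ 2 * d ^ 2 := by
    calc _ ≤ M * n * (d * (K * s) ^ 2) := by gcongr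
      _ = M * K ^ 2 * d * (n * s ^ 2) := by ring
      _ = _ := by rw [hs2]; ring
  have e : L β j - L β₀ j - n * ∑ k, A j k * (β - β₀) k =
      (L β j - L β₀ j - n * ∑ k, A j k * (β - β₀) k - ∑ k, T j k * (β - β₀) k) +
        ∑ k, T j k * (β - β₀) k := by ring
  rw [e]
  refine (abs_add_le _ _).trans ?_
  linarith

/-- The estimating function is `O(√(n d))` in a ball of radius `O(√(d / n))`. -/
lemma abs_apply_le (h : LinearizesAt L A β₀ n r M) (hM : 0 ≤ M) (hn : 0 < n) (hd : 0 < d)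
    (hdn : (d : ℝ) ^ 3 ≤ n) (hA : ∀ j, ∑ k, A j k ^ 2 ≤ hi)
    (hβ : ‖β - β₀‖ ≤ K * √((d : ℝ) / n)) (hr : K * √((d : ℝ) / n) < r) (j : Fin d) :
    |L β j| ≤ (√M + √hi * K + (√M * K + M * K ^ 2)) * (n * √((d : ℝ) / n)) := by
  have h1 := h.abs_sub_linear_le hM hn hd hβ hr j
  have hnR : (0 : ℝ) < n := by exact_mod_cast hn
  have hdR : (1 : ℝ) ≤ d := by exact_mod_cast hd
  set s := √((d : ℝ) / n) with hs
  have hspos : 0 < s := Real.sqrt_pos.2 (by positivity)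
  have hs2 : n * s ^ 2 = d := by
    rw [hs, Real.sq_sqrt (by positivity)]; field_simp
  have hK : 0 ≤ K := by
    by_contra hK
    have := (norm_nonneg (β - β₀)).trans hβ
    nlinarith
  -- Since `n s = √(n d)`, this is equivalent to `d³ ≤ n`: the `O(d²)` error does not exceed the
  -- order of the main terms.
  have hdns : (d : ℝ) ^ 2 ≤ n * s := by
    refine abs_le_of_sq_le_sq' ?_ (by positivity) |>.2
    calc ((d : ℝ) ^ 2) ^ 2 = d ^ 3 * d := by ring
      _ ≤ (n : ℝ) * d := by gcongr
      _ = ((n : ℝ) * s) ^ 2 := by rw [← hs2]; ring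
  have h2 : |L β₀ j| ≤ √M * (n * s) := by
    have hsum := (Finset.single_le_sum (f := fun j => L β₀ j ^ 2) (fun j _ => sq_nonneg _)
      (Finset.mem_univ j)).trans h.1
    refine (Real.abs_le_sqrt hsum).trans (le_of_eq ?_)
    rw [Real.sqrt_mul hM]
    congr 1
    rw [Real.sqrt_eq_iff_mul_self_eq (by positivity) (by positivity)]
    rw [← hs2]; ring
  have h3 : |n * ∑ k, A j k * (β - β₀) k| ≤ √hi * K * (n * s) := by
    rw [abs_mul, abs_of_pos hnR]
    calc _ ≤ n * (√hi * (K * s)) := by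
          gcongr
          exact (abs_sum_mul_le_mul_norm _ _ (hA j)).trans (by gcongr)
      _ = _ := by ring
  have h4 : (√M * K + M * K ^ 2) * (d : ℝ) ^ 2 ≤ (√M * K + M * K ^ 2) * (n * s) := by gcongr
  have e : L β j = (L β j - L β₀ j - n * ∑ k, A j k * (β - β₀) k) + L β₀ j +
      n * ∑ k, A j k * (β - β₀) k := by ring
  rw [e]
  refine (abs_add_le _ _).trans ((add_le_add (abs_add_le _ _) le_rfl).trans ?_)
  linarith

/-- Sparsity: where the penalty dominates, the zero components of `β₀` are zero in every root. -/
lemma eq_zero_of_isPenalizedRoot (h : LinearizesAt L A β₀ n r M) (hM : 0 ≤ M) (hn : 0 < n)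
    (hd : 0 < d) (hdn : (d : ℝ) ^ 3 ≤ n) (hA : ∀ j, ∑ k, A j k ^ 2 ≤ hi) {p : ℝ → ℝ}
    (hpen : ∀ γ : ℝ, 0 < γ → γ ≤ K * √((d : ℝ) / n) →
      √M + √hi * K + (√M * K + M * K ^ 2) + 1 ≤ √((n : ℝ) / d) * penDeriv p γ)
    (hroot : IsPenalizedRoot p n L β)
    (hβ : ‖β - β₀‖ ≤ K * √((d : ℝ) / n)) (hr : K * √((d : ℝ) / n) < r) {j : Fin d}
    (hj : β₀ j = 0) : β j = 0 := by
  by_contra hne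
  have hnR : (0 : ℝ) < n := by exact_mod_cast hn
  have hdR : (0 : ℝ) < d := by exact_mod_cast hd
  have h1 := h.abs_apply_le hM hn hd hdn hA hβ hr j
  have h2 := hpen |β j| (abs_pos.2 hne) (by
    have := abs_apply_le_norm (β - β₀) j
    simp only [PiLp.sub_apply, hj, sub_zero] at this
    exact this.trans hβ)
  -- The sign-crossing alternative for a root concerns zero components only, so here the equation
  -- holds exactly.
  have h3 : L β j = n * penDeriv p (β j) := by
    rcases hroot j with h | h
    · linarith
    · exact absurd h.1 hne
  rw [h3, abs_mul, abs_of_pos hnR] at h1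
  have h4 := penDeriv_abs_le_abs p (β j)
  have hspos : 0 < √((d : ℝ) / n) := Real.sqrt_pos.2 (by positivity)
  have hinv : √((n : ℝ) / d) * √((d : ℝ) / n) = 1 := by
    rw [← Real.sqrt_mul (by positivity)]
    field_simp
    simp
  have h5 : (√M + √hi * K + (√M * K + M * K ^ 2) + 1) * √((d : ℝ) / n) ≤ penDeriv p |β j| := by
    calc _ ≤ √((n : ℝ) / d) * penDeriv p |β j| * √((d : ℝ) / n) := by gcongr
      _ = (√((n : ℝ) / d) * √((d : ℝ) / n)) * penDeriv p |β j| := by ring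
      _ = _ := by rw [hinv, one_mul]
  have h6 := h5.trans h4
  -- The constant in `hpen` exceeds the one in `h1` by `1`, which makes the two bounds on `n
  -- |p'(β_j)|` incompatible.
  nlinarith [mul_pos hnR hspos]

/-- The residual of the linearized equation of a root at a component that is not zero. -/
lemma abs_residual_le (h : LinearizesAt L A β₀ n r M) (hM : 0 ≤ M) (hn : 0 < n) (hd : 0 < d)
    {p : ℝ → ℝ} {D : ℝ} (hD : 0 ≤ D) (hroot : IsPenalizedRoot p n L β)
    (hβ : ‖β - β₀‖ ≤ K * √((d : ℝ) / n)) (hr : K * √((d : ℝ) / n) < r) {j : Fin d}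
    (hj : β j ≠ 0 ∧ |penDeriv p (β j) - penDeriv p (β₀ j) - penDeriv2 p (β₀ j) * (β j - β₀ j)| ≤
      D * (β j - β₀ j) ^ 2) :
    |∑ k, A j k * (β - β₀) k - penDeriv2 p (β₀ j) * (β j - β₀ j) - penDeriv p (β₀ j) +
      L β₀ j / n| ≤ (√M * K + M * K ^ 2 + D * K ^ 2) * (d ^ 2 / n) := by
  have hnR : (0 : ℝ) < n := by exact_mod_cast hn
  have hdR : (1 : ℝ) ≤ d := by exact_mod_cast hd
  have h1 := h.abs_sub_linear_le hM hn hd hβ hr j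
  have h3 : L β j = n * penDeriv p (β j) := by
    rcases hroot j with h | h
    · linarith
    · exact absurd h.1 hj.1
  have hδ : (β j - β₀ j) ^ 2 ≤ K ^ 2 * (d / n) := by
    have := (abs_apply_le_norm (β - β₀) j).trans hβ
    calc (β j - β₀ j) ^ 2 = |(β - β₀) j| ^ 2 := by rw [sq_abs]; simp
      _ ≤ (K * √((d : ℝ) / n)) ^ 2 := by gcongr
      _ = _ := by rw [mul_pow, Real.sq_sqrt (by positivity)]
  have h4 : D * (β j - β₀ j) ^ 2 ≤ D * K ^ 2 * (d ^ 2 / n) := by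
    calc _ ≤ D * (K ^ 2 * (d / n)) := by gcongr
      _ ≤ D * (K ^ 2 * (d ^ 2 / n)) := by
          gcongr
          nlinarith
      _ = _ := by ring
  have h5 : |(L β j - L β₀ j - n * ∑ k, A j k * (β - β₀) k) / n| ≤
      (√M * K + M * K ^ 2) * (d ^ 2 / n) := by
    rw [abs_div, abs_of_pos hnR, mul_div_assoc']
    gcongr
  have e : ∑ k, A j k * (β - β₀) k - penDeriv2 p (β₀ j) * (β j - β₀ j) - penDeriv p (β₀ j) +
      L β₀ j / n = (penDeriv p (β j) - penDeriv p (β₀ j) - penDeriv2 p (β₀ j) * (β j - β₀ j)) -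
        (L β j - L β₀ j - n * ∑ k, A j k * (β - β₀) k) / n := by
    rw [h3]; field_simp; ring
  rw [e]
  refine (abs_sub _ _).trans ?_
  linarith [hj.2]

end LinearizesAt

lemma sum_eq_sum_castLE {d d₁ : ℕ} (h : d₁ ≤ d) {f : Fin d → ℝ}
    (hf : ∀ j : Fin d, d₁ ≤ (j : ℕ) → f j = 0) : ∑ k, f k = ∑ k, f (Fin.castLE h k) := by
  symm
  refine Finset.sum_of_injOn (Fin.castLE h) ((Fin.castLE_injective h).injOn) (by simp) ?_
    (fun _ _ => rfl)
  intro j _ hj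
  refine hf j (not_lt.1 fun hlt => hj ?_)
  exact ⟨⟨j, hlt⟩, by simp, by ext; simp⟩

/-- The standardized root differs from the standardized estimating function by at most
`O(√(d⁵ / n))`. -/
lemma LinearizesAt.abs_standardized_add_le {d d₁ n : ℕ} (hd₁ : d₁ ≤ d)
    {L : EuclideanSpace ℝ (Fin d) → EuclideanSpace ℝ (Fin d)}
    {A : Matrix (Fin d) (Fin d) ℝ} {β₀ β : EuclideanSpace ℝ (Fin d)} {r M K D lo : ℝ}
    (h : LinearizesAt L A β₀ n r M) (hM : 0 ≤ M) (hn : 0 < n) (hd : 0 < d) {p : ℝ → ℝ}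
    (hD : 0 ≤ D) (hroot : IsPenalizedRoot p n L β)
    (hβ : ‖β - β₀‖ ≤ K * √((d : ℝ) / n)) (hr : K * √((d : ℝ) / n) < r)
    (hzero : ∀ j : Fin d, d₁ ≤ (j : ℕ) → β j = 0 ∧ β₀ j = 0)
    (hpen : ∀ j : Fin d, (j : ℕ) < d₁ → β j ≠ 0 ∧
      |penDeriv p (β j) - penDeriv p (β₀ j) - penDeriv2 p (β₀ j) * (β j - β₀ j)| ≤
      D * (β j - β₀ j) ^ 2)
    {V : Matrix (Fin d₁) (Fin d₁) ℝ} {v : Fin d₁ → ℝ}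
    (hu : (invSqrt V *ᵥ v) ⬝ᵥ (invSqrt V *ᵥ v) ≤ lo)
    (hG : IsUnit (A.submatrix (Fin.castLE hd₁) (Fin.castLE hd₁) - penHess p hd₁ β₀).det) :
    |standardized n hd₁ v V (A.submatrix (Fin.castLE hd₁) (Fin.castLE hd₁) - penHess p hd₁ β₀)
        (biasVec p hd₁ β₀) β₀ β +
      (√(n : ℝ))⁻¹ * ∑ j, (invSqrt V *ᵥ v) j * L β₀ (Fin.castLE hd₁ j)| ≤
      √lo * (√M * K + M * K ^ 2 + D * K ^ 2) * √((d : ℝ) ^ 5 / n) := by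
  have hnR : (0 : ℝ) < n := by exact_mod_cast hn
  set u := invSqrt V *ᵥ v with hudef
  set G := A.submatrix (Fin.castLE hd₁) (Fin.castLE hd₁) - penHess p hd₁ β₀ with hGdef
  set δ : Fin d₁ → ℝ := fun j => β (Fin.castLE hd₁ j) - β₀ (Fin.castLE hd₁ j) with hδ
  set ρ : Fin d₁ → ℝ := fun j => (G *ᵥ δ) j - biasVec p hd₁ β₀ j + L β₀ (Fin.castLE hd₁ j) / n
    with hρ
  set C := √M * K + M * K ^ 2 + D * K ^ 2 with hC
  have hρ_le : ∀ j, |ρ j| ≤ C * (d ^ 2 / n) := by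
    intro j
    have := h.abs_residual_le hM hn hd hD hroot hβ hr (hpen (Fin.castLE hd₁ j) j.2)
    refine le_of_eq_of_le ?_ this
    congr 1
    -- Sparsity enters here: `β - β₀` vanishes beyond the first `d₁` components, so only the leading
    -- block of `A` acts.
    rw [sum_eq_sum_castLE hd₁ fun k hk => by simp [hzero k hk]]
    simp only [hρ, hGdef, Matrix.sub_mulVec, penHess, Pi.sub_apply, Matrix.mulVec_diagonal, biasVec]
    simp [Matrix.mulVec, dotProduct, hδ]
  have hstd : standardized n hd₁ v V G (biasVec p hd₁ β₀) β₀ β =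
      √(n : ℝ) * ∑ j, u j * ((G *ᵥ δ) j - biasVec p hd₁ β₀ j) := by
    -- Invertibility of `G` serves only to cancel `G G⁻¹ b = b`; no bound on `G⁻¹` is needed.
    have e : (invSqrt V * G) *ᵥ (δ - G⁻¹ *ᵥ biasVec p hd₁ β₀) =
        invSqrt V *ᵥ (G *ᵥ δ - biasVec p hd₁ β₀) := by
      rw [← Matrix.mulVec_mulVec, Matrix.mulVec_sub, Matrix.mulVec_mulVec _ G,
        Matrix.mul_nonsing_inv _ hG, Matrix.one_mulVec]
    rw [standardized, e, Matrix.dotProduct_mulVec, ← Matrix.mulVec_transpose, transpose_invSqrt]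
    rfl
  have hsum : standardized n hd₁ v V G (biasVec p hd₁ β₀) β₀ β +
      (√(n : ℝ))⁻¹ * ∑ j, u j * L β₀ (Fin.castLE hd₁ j) = √(n : ℝ) * ∑ j, u j * ρ j := by
    have hinv : (√(n : ℝ))⁻¹ = √(n : ℝ) * (1 / n) := by
      rw [mul_one_div, Real.sqrt_div_self]
    rw [hstd, hinv, mul_assoc, ← mul_add, Finset.mul_sum, ← Finset.sum_add_distrib]
    congr 1
    refine Finset.sum_congr rfl fun j _ => ?_
    simp only [hρ]
    ring
  rw [hsum, abs_mul, abs_of_nonneg (Real.sqrt_nonneg _)]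
  -- For `d₁ > 0` the sign of `C` is read off from a component of `ρ`; for `d₁ = 0` there is none
  -- and the sum is empty.
  rcases Nat.eq_zero_or_pos d₁ with h0 | hpos
  · subst h0
    have hK : 0 ≤ K := by
      by_contra hK
      have := (norm_nonneg (β - β₀)).trans hβ
      have h2 : 0 < √((d : ℝ) / n) := Real.sqrt_pos.2 (by positivity)
      nlinarith
    simp only [Finset.univ_eq_empty, Finset.sum_empty, abs_zero, mul_zero]
    positivity
  have hC0 : 0 ≤ C * (d ^ 2 / n) := (abs_nonneg _).trans (hρ_le ⟨0, hpos⟩)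
  have hCnn : 0 ≤ C := by
    have : (0 : ℝ) < d ^ 2 / n := by positivity
    exact nonneg_of_mul_nonneg_left hC0 this
  have hρ2 : ∑ j, ρ j ^ 2 ≤ d * (C * (d ^ 2 / n)) ^ 2 := by
    calc _ ≤ ∑ _j : Fin d₁, (C * ((d : ℝ) ^ 2 / n)) ^ 2 :=
          Finset.sum_le_sum fun j _ => sq_le_sq' (abs_le.1 (hρ_le j)).1 (abs_le.1 (hρ_le j)).2
      _ = d₁ * (C * (d ^ 2 / n)) ^ 2 := by simp
      _ ≤ _ := by gcongr
  have hu2 : ∑ j, u j ^ 2 ≤ lo := by simpa [dotProduct, sq] using hu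
  calc _ ≤ √(n : ℝ) * (√lo * √(d * (C * (d ^ 2 / n)) ^ 2)) := by
        gcongr
        exact abs_sum_mul_le_sqrt_mul_sqrt _ _ _ hu2 hρ2
    _ = √lo * C * √((d : ℝ) ^ 5 / n) := by
        rw [Real.sqrt_mul (by positivity), Real.sqrt_sq hC0]
        have e1 : √((d : ℝ) ^ 5 / n) = √(n : ℝ) * √(d : ℝ) * (d ^ 2 / n) := by
          rw [Real.sqrt_eq_iff_mul_self_eq (by positivity) (by positivity)]
          have a1 : √(n : ℝ) ^ 2 = n := Real.sq_sqrt hnR.le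
          have a2 : √(d : ℝ) ^ 2 = d := Real.sq_sqrt (by positivity)
          symm
          calc √(n : ℝ) * √(d : ℝ) * (d ^ 2 / n) * (√(n : ℝ) * √(d : ℝ) * (d ^ 2 / n))
              = √(n : ℝ) ^ 2 * √(d : ℝ) ^ 2 * (d ^ 2 / n) ^ 2 := by ring
            _ = _ := by rw [a1, a2]; field_simp
        rw [e1]; ring

/-- First moments of a linear combination of centered variables. -/
lemma moments_neg_linear_combination {𝒪 : Type*} [MeasurableSpace 𝒪] {P : Measure 𝒪}
    {m : ℕ} {X : Fin m → 𝒪 → ℝ} {C : ℝ}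
    (hX1 : ∀ j, Integrable (X j) P) (hX : ∀ j, MemLp (X j) 2 P) (h0 : ∀ j, ∫ o, X j o ∂P = 0)
    (hi : ∀ j k, Integrable (fun o => X j o ^ 2 * X k o ^ 2) P)
    (h4 : ∀ j k, ∫ o, X j o ^ 2 * X k o ^ 2 ∂P ≤ C) (u : Fin m → ℝ) :
    AEMeasurable (fun o => -∑ j, u j * X j o) P ∧ ∫ o, -∑ j, u j * X j o ∂P = 0 ∧
    ∫ o, (-∑ j, u j * X j o) ^ 2 ∂P =
      u ⬝ᵥ ((Matrix.of fun j k => ∫ o, X j o * X k o ∂P) *ᵥ u) ∧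
    Integrable (fun o => (-∑ j, u j * X j o) ^ 4) P ∧
    ∫ o, (-∑ j, u j * X j o) ^ 4 ∂P ≤ (u ⬝ᵥ u) ^ 2 * (m ^ 2 * C) := by
  have hmeas : AEMeasurable (fun o => -∑ j, u j * X j o) P :=
    (Finset.aemeasurable_fun_sum _ fun j _ => (hX j).aemeasurable.const_mul (u j)).neg
  -- Cauchy–Schwarz, squared, leaves only products `X_j² X_k²`, whose moments are assumed bounded;
  -- there are `m²` of them.
  have hle : ∀ o, (-∑ j, u j * X j o) ^ 4 ≤ (u ⬝ᵥ u) ^ 2 * ∑ j, ∑ k, X j o ^ 2 * X k o ^ 2 := by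
    intro o
    have := Finset.sum_mul_sq_le_sq_mul_sq Finset.univ u (fun j => X j o)
    calc (-∑ j, u j * X j o) ^ 4 = ((∑ j, u j * X j o) ^ 2) ^ 2 := by ring
      _ ≤ ((∑ j, u j ^ 2) * ∑ j, X j o ^ 2) ^ 2 := by gcongr
      _ = (∑ j, u j ^ 2) ^ 2 * ((∑ j, X j o ^ 2) * ∑ j, X j o ^ 2) := by ring
      _ = _ := by
          rw [Finset.sum_mul_sum]
          simp [dotProduct, sq]
  have hbi : Integrable (fun o => (u ⬝ᵥ u) ^ 2 * ∑ j, ∑ k, X j o ^ 2 * X k o ^ 2) P :=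
    (integrable_finsetSum _ fun j _ => integrable_finsetSum _ fun k _ => hi j k).const_mul _
  have hi4 : Integrable (fun o => (-∑ j, u j * X j o) ^ 4) P :=
    hbi.mono' (hmeas.pow_const 4).aestronglyMeasurable (ae_of_all _ fun o => by
      rw [Real.norm_of_nonneg (by positivity)]; exact hle o)
  refine ⟨hmeas, ?_, ?_, hi4, ?_⟩
  · rw [integral_neg, integral_finsetSum _ fun j _ => (hX1 j).const_mul (u j)]
    simp [integral_const_mul, h0]
  · have hjk : ∀ j k, Integrable (fun o => u j * (X j o * X k o * u k)) P := fun j k =>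
      (((hX j).integrable_mul (hX k)).mul_const (u k)).const_mul (u j)
    have e : ∀ o, (-∑ j, u j * X j o) ^ 2 = ∑ j, ∑ k, u j * (X j o * X k o * u k) := fun o => by
      rw [neg_sq, sq, Finset.sum_mul_sum]
      exact Finset.sum_congr rfl fun j _ => Finset.sum_congr rfl fun k _ => by ring
    simp_rw [e]
    rw [integral_finsetSum _ fun j _ => integrable_finsetSum _ fun k _ => hjk j k]
    simp only [dotProduct, Matrix.mulVec, Matrix.of_apply, Finset.mul_sum]
    refine Finset.sum_congr rfl fun j _ => ?_
    rw [integral_finsetSum _ fun k _ => hjk j k]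
    refine Finset.sum_congr rfl fun k _ => ?_
    rw [integral_const_mul, integral_mul_const]
  · refine (integral_mono hi4 hbi hle).trans ?_
    rw [integral_const_mul]
    gcongr
    rw [integral_finsetSum _ fun j _ => integrable_finsetSum _ fun k _ => hi j k]
    calc _ ≤ ∑ _j : Fin m, ∑ _k : Fin m, C := by
          refine Finset.sum_le_sum fun j _ => ?_
          rw [integral_finsetSum _ fun k _ => hi j k]
          exact Finset.sum_le_sum fun k _ => h4 j k
      _ = m ^ 2 * C := by simp; ring

/-! ### Moments and linearization of the locally efficient score -/

namespace MEModel

variable {𝒳 𝒵 𝒲 𝒴 : Type*} [MeasurableSpace 𝒳] [MeasurableSpace 𝒵]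
  [MeasurableSpace 𝒲] [MeasurableSpace 𝒴] {d d₁ : ℕ} {M : MEModel 𝒳 𝒵 𝒲 𝒴 d}
  {a : EuclideanSpace ℝ (Fin d) → 𝒳 → 𝒵 → EuclideanSpace ℝ (Fin d)}
  {β₀ : EuclideanSpace ℝ (Fin d)} {h : d₁ ≤ d} {lo hi r C₁ C₂ C₃ C₄ C₅ : ℝ}

lemma isHermitian_covI : (M.covI a β₀ h).IsHermitian := by
  ext j k
  simp [covI, mul_comm]

variable [IsProbabilityMeasure (M.obsLaw β₀)]

/-- From `s² ≤ 1 + s⁴` and the diagonal case of the fourth moment condition. This reaches all `d`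
components, whereas the eigenvalues of `V` concern only the first `d₁`. -/
lemma CondA2.memLp_effScore (hA2 : M.CondA2 a β₀ h C₂ C₃ C₄)
    (hm : AEMeasurable (fun o => M.effScore a o β₀) (M.obsLaw β₀)) (j : Fin d) :
    MemLp (fun o => M.effScore a o β₀ j) 2 (M.obsLaw β₀) ∧
      ∫ o, M.effScore a o β₀ j ^ 2 ∂(M.obsLaw β₀) ≤ 1 + C₄ := by
  have hmj : AEMeasurable (fun o => M.effScore a o β₀ j) (M.obsLaw β₀) :=
    (EuclideanSpace.proj j : EuclideanSpace ℝ (Fin d) →L[ℝ] ℝ).measurable.comp_aemeasurable hm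
  have hle : ∀ o, M.effScore a o β₀ j ^ 2 ≤
      1 + M.effScore a o β₀ j ^ 2 * M.effScore a o β₀ j ^ 2 := fun o => by
    nlinarith [sq_nonneg (M.effScore a o β₀ j ^ 2 - 1)]
  have hbi := (integrable_const (μ := M.obsLaw β₀) (1 : ℝ)).add (hA2.integrable j j)
  have hint : Integrable (fun o => M.effScore a o β₀ j ^ 2) (M.obsLaw β₀) :=
    hbi.mono' (hmj.pow_const 2).aestronglyMeasurable (ae_of_all _ fun o => by
      rw [Real.norm_of_nonneg (by positivity)]; exact hle o)
  refine ⟨(memLp_two_iff_integrable_sq hmj.aestronglyMeasurable).2 hint, ?_⟩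
  refine (integral_mono hint hbi hle).trans ?_
  simp only [Pi.add_apply]
  rw [integral_add (integrable_const _) (hA2.integrable j j)]
  simpa using hA2.moment j j

lemma integral_effScore_apply_eq_zero (ha : M.SolvesIntegralEq a)
    (hA2 : M.CondA2 a β₀ h C₂ C₃ C₄)
    (hm : AEMeasurable (fun o => M.effScore a o β₀) (M.obsLaw β₀)) (j : Fin d) :
    ∫ o, M.effScore a o β₀ j ∂(M.obsLaw β₀) = 0 := by
  have hi : ∀ j, Integrable (fun o => M.effScore a o β₀ j) (M.obsLaw β₀) := fun j =>
    (hA2.memLp_effScore hm j).1.integrable (by norm_num)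
  have h1 := eval_integral_piLp (q := 2) (f := fun o => M.effScore a o β₀) hi j
  rw [integral_effScore_eq_zero M ha (Integrable.of_eval_piLp hi)] at h1
  simpa using h1.symm

/-- With high probability the sum of the locally efficient scores is close to its linearization. -/
lemma measure_not_linearizesAt_le {Ω : Type*} [MeasurableSpace Ω] {μ : Measure Ω}
    [IsProbabilityMeasure μ] {n : ℕ} (hn : 0 < n) (hd : 0 < d)
    {O : Fin n → Ω → 𝒲 × 𝒵 × 𝒴} (hO : ∀ i, HasLaw (O i) (M.obsLaw β₀) μ) (hind : iIndepFun O μ)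
    (ha : M.SolvesIntegralEq a) (hA1 : M.CondA1 a β₀ lo hi C₁) (hA2 : M.CondA2 a β₀ h C₂ C₃ C₄)
    (hA3 : M.CondA3 a β₀ r C₅) (hr : 0 < r) {B : ℝ} (hB : 0 < B) :
    μ {ω | ¬ LinearizesAt (fun β => ∑ i, M.effScore a (O i ω) β) (M.meanDeriv a β₀) β₀ n r B} ≤
      3 * ENNReal.ofReal ((|C₁| + (1 + |C₄|) + |C₅| + 1) / B) := by
  have hm := hA3.aemeasurable β₀ (Metric.mem_ball_self hr)
  obtain ⟨b, hbm, hbi, hb, hbound⟩ := hA3.bound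
  refine _root_.measure_not_linearizesAt_le (S := M.effScore a) hn hd hO hind hB
    (fun j => (hA2.memLp_effScore hm j).1) (integral_effScore_apply_eq_zero ha hA2 hm) ?_
    (fun j k => (memLp_two_iff_integrable_sq (hA1.integrable j k).aestronglyMeasurable).2
      (hA1.integrable_sq j k)) (fun j k => rfl) ?_
    ((memLp_two_iff_integrable_sq hbm.aestronglyMeasurable).2 hbi) ?_ hbound
  · intro j
    refine (hA2.memLp_effScore hm j).2.trans ?_
    linarith [le_abs_self C₄, abs_nonneg C₁, abs_nonneg C₅]
  · intro j k
    refine (hA1.moment j k).trans ?_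
    linarith [abs_nonneg C₄, le_abs_self C₁, abs_nonneg C₅]
  · linarith [abs_nonneg C₄, abs_nonneg C₁, le_abs_self C₅]

end MEModel

/-! ### Asymptotics -/

lemma tendsto_pow_div_of_le {d : ℕ → ℕ} (hd : ∀ n, 0 < d n)
    (hrate : Tendsto (fun n : ℕ => (d n : ℝ) ^ 5 / n) atTop (𝓝 0)) {k : ℕ} (hk : k ≤ 5) :
    Tendsto (fun n : ℕ => (d n : ℝ) ^ k / n) atTop (𝓝 0) := by
  refine squeeze_zero (fun n => by positivity) (fun n => ?_) hrate
  have : (1 : ℝ) ≤ d n := by exact_mod_cast hd n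
  gcongr

lemma tendsto_mul_sqrt_div {d : ℕ → ℕ} (hd : ∀ n, 0 < d n)
    (hrate : Tendsto (fun n : ℕ => (d n : ℝ) ^ 5 / n) atTop (𝓝 0)) (K : ℝ) :
    Tendsto (fun n : ℕ => K * √((d n : ℝ) / n)) atTop (𝓝 0) := by
  have := ((tendsto_pow_div_of_le hd hrate (k := 1) (by norm_num)).sqrt).const_mul K
  simpa using this

lemma eventually_pow_three_le {d : ℕ → ℕ} (hd : ∀ n, 0 < d n)
    (hrate : Tendsto (fun n : ℕ => (d n : ℝ) ^ 5 / n) atTop (𝓝 0)) :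
    ∀ᶠ n : ℕ in atTop, (d n : ℝ) ^ 3 ≤ n := by
  filter_upwards [(tendsto_pow_div_of_le hd hrate (k := 3) (by norm_num)).eventually_lt_const
    one_pos, eventually_gt_atTop 0] with n h hn
  have hnR : (0 : ℝ) < n := by exact_mod_cast hn
  rw [div_lt_one hnR] at h
  exact h.le

lemma exists_three_mul_ofReal_div_le (c : ℝ) {η : ENNReal} (hη : 0 < η) :
    ∃ B : ℝ, 0 < B ∧ 3 * ENNReal.ofReal (c / B) ≤ η := by
  have h : Tendsto (fun B : ℝ => 3 * ENNReal.ofReal (c / B)) atTop (𝓝 (3 * ENNReal.ofReal 0)) :=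
    ENNReal.Tendsto.const_mul (ENNReal.tendsto_ofReal (tendsto_const_nhds.div_atTop tendsto_id))
      (Or.inr (by simp))
  rw [ENNReal.ofReal_zero, mul_zero] at h
  obtain ⟨B, hB, hB0⟩ := ((h.eventually_le_const hη).and (eventually_gt_atTop 0)).exists
  exact ⟨B, hB0, hB⟩

/-- In the neighbourhoods of radius `O(√(d_n / n))` of the true values the derivative of the
penalty is uniformly close to its linearization at the nonzero components. -/
lemma CondP1.eventually_taylor {p : ℝ → ℝ → ℝ} {lam : ℕ → ℝ} {d : ℕ → ℕ}
    {β₀ : ∀ n, EuclideanSpace ℝ (Fin (d n))} (hP1 : CondP1 p lam β₀) (hd : ∀ n, 0 < d n)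
    (hlam_pos : ∀ n, 0 < lam n)
    (hβmin : ∀ K : ℝ, ∀ᶠ n in atTop, ∀ j, β₀ n j ≠ 0 → K * lam n ≤ |β₀ n j|)
    (hpen : PenaltyDominates p lam d) :
    ∃ D : ℝ, 0 ≤ D ∧ ∀ K : ℝ, 0 < K → ∀ᶠ n : ℕ in atTop, ∀ β : EuclideanSpace ℝ (Fin (d n)),
      ‖β - β₀ n‖ ≤ K * √((d n : ℝ) / n) → ∀ j, β₀ n j ≠ 0 →
        β j ≠ 0 ∧ |penDeriv (p (lam n)) (β j) - penDeriv (p (lam n)) (β₀ n j) -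
          penDeriv2 (p (lam n)) (β₀ n j) * (β j - β₀ n j)| ≤ D * (β j - β₀ n j) ^ 2 := by
  obtain ⟨C, D, hC, hCD⟩ := hP1.smooth
  have hD : 0 ≤ D := by
    have := (abs_nonneg _).trans ((hCD 0).2 (C * lam 0 + 1) (C * lam 0 + 2) (by linarith)
      (by linarith))
    have e : |C * lam 0 + 1 - (C * lam 0 + 2)| = 1 := by
      rw [show C * lam 0 + 1 - (C * lam 0 + 2) = -1 by ring]; simp
    rwa [e, mul_one] at this
  obtain ⟨c, hc⟩ := hP1.first.bound
  refine ⟨D, hD, fun K hK => ?_⟩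
  -- The factor `2 * C + 1` makes `C λ_n` strictly smaller than `|β_{j0}| / 2`; the factor `2 * K`
  -- makes the estimation error at most `|β_{j0}| / 2`.
  filter_upwards [hβmin (2 * C + 1), hpen (2 * K) (by positivity) (c + 1), hc,
    eventually_gt_atTop 0] with n h1 h2 h3 hn β hβ j hj
  have hnR : (0 : ℝ) < n := by exact_mod_cast hn
  have hdR : (1 : ℝ) ≤ d n := by exact_mod_cast hd n
  -- A non-zero coefficient within `2K √(d/n)` of the origin would have `p'` at least `(c + 1)
  -- √(d/n)` by domination, yet `p'` is at most `c / √n` at the true coefficients, and `d ≥ 1`.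
  have hfar : 2 * K * √((d n : ℝ) / n) < |β₀ n j| := by
    by_contra hcon
    have h4 := h2 |β₀ n j| (abs_pos.2 hj) (not_lt.1 hcon)
    have h5 : abs (penDeriv (p (lam n)) |β₀ n j|) ≤ c * (1 / √(n : ℝ)) := by
      have hmax : abs (penDeriv (p (lam n)) |β₀ n j|) ≤ maxPenDeriv (p (lam n)) (β₀ n) :=
        le_ciSup (f := fun j : {j : Fin (d n) // β₀ n j ≠ 0} =>
          abs (penDeriv (p (lam n)) |β₀ n j|)) (Set.finite_range _).bddAbove ⟨j, hj⟩
      refine hmax.trans ((le_abs_self _).trans (h3.trans (le_of_eq ?_)))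
      rw [Real.norm_of_nonneg (by positivity)]
    have h6 : √((n : ℝ) / d n) ≤ √(n : ℝ) := Real.sqrt_le_sqrt (div_le_self hnR.le hdR)
    have h7 : √((n : ℝ) / d n) * penDeriv (p (lam n)) |β₀ n j| ≤ c := by
      have hnn : 0 ≤ c * (1 / √(n : ℝ)) := (abs_nonneg _).trans h5
      calc _ ≤ √((n : ℝ) / d n) * (c * (1 / √(n : ℝ))) := by
            gcongr
            exact (le_abs_self _).trans h5
        _ ≤ √(n : ℝ) * (c * (1 / √(n : ℝ))) := by gcongr
        _ = c := by
            have : 0 < √(n : ℝ) := Real.sqrt_pos.2 hnR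
            field_simp
    linarith
  have h8 := (abs_apply_le_norm (β - β₀ n) j).trans hβ
  rw [PiLp.sub_apply] at h8
  refine abs_penDeriv_taylor_le (mul_nonneg hC (hlam_pos n).le) (hCD n).1 (hCD n).2 ?_ ?_
  · linarith [h1 j hj, hlam_pos n]
  · linarith

/-! ### Sparsity and asymptotic normality -/

theorem theorem2
    {𝒳 𝒵 𝒲 𝒴 Ω : ℕ → Type*}
    [∀ n, MeasurableSpace (𝒳 n)] [∀ n, MeasurableSpace (𝒵 n)]
    [∀ n, MeasurableSpace (𝒲 n)] [∀ n, MeasurableSpace (𝒴 n)]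
    [∀ n, MeasurableSpace (Ω n)]
    (μ : ∀ n, Measure (Ω n)) [∀ n, IsProbabilityMeasure (μ n)]
    (d d₁ : ℕ → ℕ) (hd : ∀ n, 0 < d n) (hd₁ : ∀ n, d₁ n ≤ d n)
    -- the models, the functions `a(X, Z)`, the true values and the samples
    (M : ∀ n, MEModel (𝒳 n) (𝒵 n) (𝒲 n) (𝒴 n) (d n))
    (a : ∀ n, EuclideanSpace ℝ (Fin (d n)) → 𝒳 n → 𝒵 n → EuclideanSpace ℝ (Fin (d n)))
    (ha : ∀ n, (M n).SolvesIntegralEq (a n))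
    (β₀ : ∀ n, EuclideanSpace ℝ (Fin (d n)))
    (hβ₀ : ∀ n, ∀ j : Fin (d n), β₀ n j ≠ 0 ↔ (j : ℕ) < d₁ n)
    (O : ∀ n, Fin n → Ω n → 𝒲 n × 𝒵 n × 𝒴 n)
    (hO : ∀ n i, HasLaw (O n i) ((M n).obsLaw (β₀ n)) (μ n))
    (hindep : ∀ n, iIndepFun (O n) (μ n))
    -- the penalty
    (p : ℝ → ℝ → ℝ) (lam : ℕ → ℝ) (hlam_pos : ∀ n, 0 < lam n)
    (hp : ∀ n, DifferentiableOn ℝ (p (lam n)) (Set.Ioi 0))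
    (hP1 : CondP1 p lam β₀)
    (hβmin : ∀ K : ℝ, ∀ᶠ n in atTop, ∀ j, β₀ n j ≠ 0 → K * lam n ≤ |β₀ n j|)
    (hpen : PenaltyDominates p lam d)
    -- the regularity conditions
    (hA1 : ∃ lo hi C₁ : ℝ, 0 < lo ∧ ∀ n, (M n).CondA1 (a n) (β₀ n) lo hi C₁)
    (hA2 : ∃ C₂ C₃ C₄ : ℝ, 0 < C₂ ∧ ∀ n, (M n).CondA2 (a n) (β₀ n) (hd₁ n) C₂ C₃ C₄)
    (hA3 : ∃ r C₅ : ℝ, 0 < r ∧ ∀ n, (M n).CondA3 (a n) (β₀ n) r C₅)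
    (hlam : Tendsto lam atTop (𝓝 0))
    (hrate : Tendsto (fun n : ℕ => (d n : ℝ) ^ 5 / n) atTop (𝓝 0)) :
    -- sparsity, for all roots at once
    (∀ K : ℝ, Tendsto (fun n : ℕ => μ n {ω | ∃ β : EuclideanSpace ℝ (Fin (d n)),
        IsPenalizedRoot (p (lam n)) n
          (fun β' => ∑ i, (M n).effScore (a n) (O n i ω) β') β ∧
        ‖β - β₀ n‖ ≤ K * √((d n : ℝ) / n) ∧
        ∃ j : Fin (d n), d₁ n ≤ (j : ℕ) ∧ β j ≠ 0}) atTop (𝓝 0)) ∧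
    -- every root-(n/d_n)-consistent sequence of solutions
    (∀ βhat : ∀ n, Ω n → EuclideanSpace ℝ (Fin (d n)),
      (∀ n, AEMeasurable (βhat n) (μ n)) →
      Tendsto (fun n : ℕ => μ n {ω | ¬ IsPenalizedRoot (p (lam n)) n
          (fun β' => ∑ i, (M n).effScore (a n) (O n i ω) β') (βhat n ω)}) atTop (𝓝 0) →
      (∀ ε : ENNReal, 0 < ε → ∃ K : ℝ, ∀ᶠ n : ℕ in atTop,
        μ n {ω | K * √((d n : ℝ) / n) < ‖βhat n ω - β₀ n‖} ≤ ε) →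
      Tendsto (fun n : ℕ => μ n {ω | ∃ j : Fin (d n), d₁ n ≤ (j : ℕ) ∧ βhat n ω j ≠ 0})
        atTop (𝓝 0) ∧
      ((∀ᶠ n in atTop, IsUnit
          ((M n).meanDerivI (a n) (β₀ n) (hd₁ n) - penHess (p (lam n)) (hd₁ n) (β₀ n)).det) →
        ∀ v : ∀ n, Fin (d₁ n) → ℝ, (∀ᶠ n in atTop, v n ⬝ᵥ v n = 1) →
          TendstoInDistribution
            (fun n ω => standardized n (hd₁ n) (v n)
              ((M n).covI (a n) (β₀ n) (hd₁ n))
              ((M n).meanDerivI (a n) (β₀ n) (hd₁ n) - penHess (p (lam n)) (hd₁ n) (β₀ n))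
              (biasVec (p (lam n)) (hd₁ n) (β₀ n)) (β₀ n) (βhat n ω))
            atTop (id : ℝ → ℝ) μ (gaussianReal 0 1))) := by
  obtain ⟨lo, hi, C₁, hlo, hA1⟩ := hA1
  obtain ⟨C₂, C₃, C₄, hC₂, hA2⟩ := hA2
  obtain ⟨r, C₅, hr, hA3⟩ := hA3
  obtain ⟨D, hD, hTaylor⟩ := hP1.eventually_taylor hd hlam_pos hβmin hpen
  -- The total mass is inherited from the law of an observation, so the sample must be non-empty.
  have hprob : ∀ n, 0 < n → IsProbabilityMeasure ((M n).obsLaw (β₀ n)) := fun n hn =>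
    (hO n ⟨0, hn⟩).isProbabilityMeasure_iff.1 inferInstance
  set A : ∀ n, Matrix (Fin (d n)) (Fin (d n)) ℝ := fun n => (M n).meanDeriv (a n) (β₀ n) with hA
  set L : ∀ n, Ω n → EuclideanSpace ℝ (Fin (d n)) → EuclideanSpace ℝ (Fin (d n)) :=
    fun n ω β' => ∑ i, (M n).effScore (a n) (O n i ω) β' with hL
  have hzero : ∀ n, ∀ j : Fin (d n), d₁ n ≤ (j : ℕ) → β₀ n j = 0 := fun n j hj => by
    by_contra h
    exact absurd ((hβ₀ n j).1 h) (not_lt.2 hj)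
  have hlin : ∀ η : ENNReal, 0 < η → ∃ B : ℝ, 0 < B ∧ ∀ᶠ n : ℕ in atTop,
      μ n {ω | ¬ LinearizesAt (L n ω) (A n) (β₀ n) n r B} ≤ η := by
    intro η hη
    obtain ⟨B, hB, hBη⟩ := exists_three_mul_ofReal_div_le (|C₁| + (1 + |C₄|) + |C₅| + 1) hη
    refine ⟨B, hB, ?_⟩
    filter_upwards [eventually_gt_atTop 0] with n hn
    have := hprob n hn
    exact (MEModel.measure_not_linearizesAt_le hn (hd n) (hO n) (hindep n) (ha n) (hA1 n) (hA2 n)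
      (hA3 n) hr hB).trans hBη
  have hsparse : ∀ B : ℝ, 0 < B → ∀ K : ℝ, ∀ᶠ n : ℕ in atTop, ∀ ω,
      LinearizesAt (L n ω) (A n) (β₀ n) n r B → ∀ β, IsPenalizedRoot (p (lam n)) n (L n ω) β →
      ‖β - β₀ n‖ ≤ K * √((d n : ℝ) / n) → ∀ j : Fin (d n), d₁ n ≤ (j : ℕ) → β j = 0 := by
    intro B hB K
    -- Enlarging the radius to `|K| + 1` allows `K` of any sign, while domination is assumed for
    -- positive constants.
    have hK : 0 < |K| + 1 := by positivity
    filter_upwards [eventually_gt_atTop 0, eventually_pow_three_le hd hrate,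
      hpen (|K| + 1) hK (√B + √hi * (|K| + 1) + (√B * (|K| + 1) + B * (|K| + 1) ^ 2) + 1),
      (tendsto_mul_sqrt_div hd hrate (|K| + 1)).eventually_lt_const hr]
      with n hn hdn hpn hrn ω hlinω β hroot hβ j hj
    refine hlinω.eq_zero_of_isPenalizedRoot hB.le hn (hd n) hdn
      (fun j => (hA1 n).eigenvalues.sum_sq_row_le j) hpn hroot (hβ.trans ?_) hrn (hzero n j hj)
    gcongr
    linarith [le_abs_self K]
  have hbad : ∀ βhat : ∀ n, Ω n → EuclideanSpace ℝ (Fin (d n)),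
      Tendsto (fun n : ℕ => μ n {ω | ¬ IsPenalizedRoot (p (lam n)) n (L n ω) (βhat n ω)}) atTop
        (𝓝 0) →
      (∀ ε : ENNReal, 0 < ε → ∃ K : ℝ, ∀ᶠ n : ℕ in atTop,
        μ n {ω | K * √((d n : ℝ) / n) < ‖βhat n ω - β₀ n‖} ≤ ε) →
      ∀ η : ENNReal, 0 < η → ∃ B K : ℝ, 0 < B ∧ 0 < K ∧ ∀ᶠ n : ℕ in atTop,
        μ n {ω | ¬ (LinearizesAt (L n ω) (A n) (β₀ n) n r B ∧
          IsPenalizedRoot (p (lam n)) n (L n ω) (βhat n ω) ∧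
          ‖βhat n ω - β₀ n‖ ≤ K * √((d n : ℝ) / n))} ≤ η := by
    intro βhat hroot hrateβ η hη
    have hη3 : 0 < η / 3 := ENNReal.div_pos hη.ne' (by simp)
    obtain ⟨B, hB, hBη⟩ := hlin _ hη3
    obtain ⟨K, hK⟩ := hrateβ _ hη3
    refine ⟨B, |K| + 1, hB, by positivity, ?_⟩
    filter_upwards [hBη, hK, hroot.eventually_le_const hη3] with n h1 h2 h3
    have hsub : {ω | ¬ (LinearizesAt (L n ω) (A n) (β₀ n) n r B ∧
          IsPenalizedRoot (p (lam n)) n (L n ω) (βhat n ω) ∧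
          ‖βhat n ω - β₀ n‖ ≤ (|K| + 1) * √((d n : ℝ) / n))} ⊆
        ({ω | ¬ LinearizesAt (L n ω) (A n) (β₀ n) n r B} ∪
          {ω | ¬ IsPenalizedRoot (p (lam n)) n (L n ω) (βhat n ω)}) ∪
          {ω | K * √((d n : ℝ) / n) < ‖βhat n ω - β₀ n‖} := by
      intro ω hω
      by_contra hcon
      simp only [Set.mem_union, Set.mem_ofPred_eq, not_or, not_not, not_lt] at hcon hω
      refine hω ⟨hcon.1.1, hcon.1.2, hcon.2.trans ?_⟩
      gcongr
      linarith [le_abs_self K]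
    refine (measure_mono hsub).trans ((measure_union_le _ _).trans ?_)
    refine (add_le_add (measure_union_le _ _) le_rfl).trans ?_
    calc _ ≤ η / 3 + η / 3 + η / 3 := add_le_add (add_le_add h1 h3) h2
      _ = η := ENNReal.add_thirds η
  refine ⟨fun K => ?_, fun βhat hβmeas hroot hrateβ => ⟨?_, fun hG v hv => ?_⟩⟩
  · rw [ENNReal.tendsto_nhds_zero]
    intro η hη
    obtain ⟨B, hB, hBη⟩ := hlin η hη
    filter_upwards [hBη, hsparse B hB K] with n h1 h2
    -- The event ranges over uncountably many `β` and need not be measurable; monotonicity of the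
    -- outer measure is enough.
    refine (measure_mono ?_).trans h1
    rw [Set.ofPred_subset_ofPred]
    rintro ω ⟨β, hβroot, hβ, j, hj, hne⟩ hlinω
    exact hne (h2 ω hlinω β hβroot hβ j hj)
  · rw [ENNReal.tendsto_nhds_zero]
    intro η hη
    obtain ⟨B, K, hB, -, hBK⟩ := hbad βhat hroot hrateβ η hη
    filter_upwards [hBK, hsparse B hB K] with n h1 h2
    refine (measure_mono ?_).trans h1
    rw [Set.ofPred_subset_ofPred]
    rintro ω ⟨j, hj, hne⟩ ⟨hlinω, hrootω, hβω⟩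
    exact hne (h2 ω hlinω _ hrootω hβω j hj)
  · set V : ∀ n, Matrix (Fin (d₁ n)) (Fin (d₁ n)) ℝ := fun n => (M n).covI (a n) (β₀ n) (hd₁ n)
      with hVdef
    have hV : ∀ n, (V n).PosDef := fun n =>
      (hA2 n).eigenvalues.posDef hC₂ MEModel.isHermitian_covI
    set u : ∀ n, Fin (d₁ n) → ℝ := fun n => invSqrt (V n) *ᵥ v n with hudef
    have huV : ∀ᶠ n in atTop, u n ⬝ᵥ (V n *ᵥ u n) = 1 := by
      filter_upwards [hv] with n hn
      rw [← hn]
      exact invSqrt_mulVec_quadForm (hV n) (v n)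
    -- From `C₂ |u|² ≤ uᵀ V u = 1`.
    have hu : ∀ᶠ n in atTop, u n ⬝ᵥ u n ≤ 1 / C₂ := by
      filter_upwards [huV] with n hn
      rw [le_div_iff₀' hC₂, ← hn]
      exact (hA2 n).eigenvalues.le_dotProduct MEModel.isHermitian_covI (u n)
    -- The minus sign comes from `G δ_I - b ≈ -L_I(β₀)/n`.
    set f : ∀ n, 𝒲 n × 𝒵 n × 𝒴 n → ℝ := fun n o =>
      -∑ j, u n j * (M n).effScore (a n) o (β₀ n) (Fin.castLE (hd₁ n) j) with hf
    have hmom : ∀ n, 0 < n → AEMeasurable (f n) ((M n).obsLaw (β₀ n)) ∧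
        ∫ o, f n o ∂((M n).obsLaw (β₀ n)) = 0 ∧
        ∫ o, f n o ^ 2 ∂((M n).obsLaw (β₀ n)) = u n ⬝ᵥ (V n *ᵥ u n) ∧
        Integrable (fun o => f n o ^ 4) ((M n).obsLaw (β₀ n)) ∧
        ∫ o, f n o ^ 4 ∂((M n).obsLaw (β₀ n)) ≤ (u n ⬝ᵥ u n) ^ 2 * ((d₁ n) ^ 2 * C₄) := by
      intro n hn
      have := hprob n hn
      have hm := (hA3 n).aemeasurable (β₀ n) (Metric.mem_ball_self hr)
      exact moments_neg_linear_combination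
        (X := fun j o => (M n).effScore (a n) o (β₀ n) (Fin.castLE (hd₁ n) j))
        (fun j => ((hA2 n).memLp_effScore hm _).1.integrable (by norm_num))
        (fun j => ((hA2 n).memLp_effScore hm _).1)
        (fun j => MEModel.integral_effScore_apply_eq_zero (ha n) (hA2 n) hm _)
        (fun j k => (hA2 n).integrable _ _) (fun j k => (hA2 n).moment _ _) (u n)
    have hint : ∀ n, 0 < n → ∀ k : ℕ, ∫ x, x ^ k ∂(((M n).obsLaw (β₀ n)).map (f n)) =
        ∫ o, f n o ^ k ∂((M n).obsLaw (β₀ n)) := fun n hn k =>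
      integral_map (hmom n hn).1 (by fun_prop)
    refine tendstoInDistribution_of_sub_iid_sum μ ?_ (ξ := fun n i ω => f n (O n i ω))
      (ν := fun n => ((M n).obsLaw (β₀ n)).map (f n)) ?_ ?_ ?_ ?_
    · intro n
      have hc : Continuous fun β : EuclideanSpace ℝ (Fin (d n)) =>
          standardized n (hd₁ n) (v n) (V n)
            ((M n).meanDerivI (a n) (β₀ n) (hd₁ n) - penHess (p (lam n)) (hd₁ n) (β₀ n))
            (biasVec (p (lam n)) (hd₁ n) (β₀ n)) (β₀ n) β := by
        unfold standardized
        fun_prop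
      exact hc.measurable.comp_aemeasurable (hβmeas n)
    · filter_upwards [eventually_gt_atTop 0] with n hn
      exact ⟨fun i => HasLaw.fun_comp (Y := f n) ⟨(hmom n hn).1, rfl⟩ (hO n i),
        iIndepFun_comp_hasLaw (hO n) (hindep n) (hmom n hn).1⟩
    · filter_upwards [eventually_gt_atTop 0, huV] with n hn hun
      have := hprob n hn
      refine ⟨Measure.isProbabilityMeasure_map (hmom n hn).1, ?_, ?_, ?_⟩
      · simpa [(hmom n hn).2.1] using hint n hn 1
      · rw [hint n hn 2, (hmom n hn).2.2.1, hun]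
      · rw [integrable_map_measure (by fun_prop) (hmom n hn).1]
        exact (hmom n hn).2.2.2.1
    -- The fourth moment is at most `|u|⁴ d₁² C₄`, and `|u|² ≤ 1 / C₂`; after division by `n` it is
    -- `O(d²/n)`.
    · have hlim : Tendsto (fun n : ℕ => (1 / C₂) ^ 2 * |C₄| * ((d n : ℝ) ^ 2 / n)) atTop (𝓝 0) := by
        have := (tendsto_pow_div_of_le hd hrate (k := 2) (by norm_num)).const_mul
          ((1 / C₂) ^ 2 * |C₄|)
        rwa [mul_zero] at this
      refine squeeze_zero' (Eventually.of_forall fun n => div_nonneg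
        (integral_nonneg fun x => by positivity) (Nat.cast_nonneg n)) ?_ hlim
      filter_upwards [eventually_gt_atTop 0, hu] with n hn hun
      have hd₁R : (d₁ n : ℝ) ≤ d n := by exact_mod_cast hd₁ n
      have huu : 0 ≤ u n ⬝ᵥ u n := by
        rw [dotProduct]; exact Finset.sum_nonneg fun j _ => mul_self_nonneg _
      rw [hint n hn 4, mul_div_assoc']
      gcongr
      calc _ ≤ (u n ⬝ᵥ u n) ^ 2 * ((d₁ n) ^ 2 * C₄) := (hmom n hn).2.2.2.2
        _ ≤ (u n ⬝ᵥ u n) ^ 2 * ((d₁ n) ^ 2 * |C₄|) := by gcongr; exact le_abs_self _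
        _ ≤ (1 / C₂) ^ 2 * ((d n) ^ 2 * |C₄|) := by gcongr
        _ = _ := by ring
    · intro ε hε
      rw [ENNReal.tendsto_nhds_zero]
      intro η hη
      obtain ⟨B, K, hB, hK, hBK⟩ := hbad βhat hroot hrateβ η hη
      have hlim : Tendsto (fun n : ℕ => √(1 / C₂) * (√B * K + B * K ^ 2 + D * K ^ 2) *
          √((d n : ℝ) ^ 5 / n)) atTop (𝓝 0) := by
        simpa using (hrate.sqrt).const_mul (√(1 / C₂) * (√B * K + B * K ^ 2 + D * K ^ 2))
      filter_upwards [hBK, hsparse B hB K, hTaylor K hK, eventually_gt_atTop 0, hu, hG,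
        (tendsto_mul_sqrt_div hd hrate K).eventually_lt_const hr, hlim.eventually_lt_const hε]
        with n h1 h2 h3 hn hun hGn hrn hεn
      refine (measure_mono ?_).trans h1
      rw [Set.ofPred_subset_ofPred]
      rintro ω hω ⟨hlinω, hrootω, hβω⟩
      have hmain := hlinω.abs_standardized_add_le (hd₁ n) hB.le hn (hd n) hD hrootω hβω hrn
        (fun j hj => ⟨h2 ω hlinω _ hrootω hβω j hj, hzero n j hj⟩)
        (fun j hj => h3 _ hβω j ((hβ₀ n j).2 hj)) hun hGn
      -- On the good event the deterministic `O(√(d⁵/n))` bound is below `ε`, so the deviation can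
      -- exceed `ε` only off that event.
      refine absurd (hω.trans (le_of_eq_of_le ?_ hmain)) (not_le.2 hεn)
      have hs : ∑ i, f n (O n i ω) = -∑ j, u n j * L n ω (β₀ n) (Fin.castLE (hd₁ n) j) := by
        simp only [hf, hL, Finset.sum_neg_distrib, WithLp.ofLp_sum, Finset.sum_apply,
          Finset.mul_sum]
        rw [Finset.sum_comm]
      rw [hs, mul_neg, sub_neg_eq_add]
      rfl
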